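/- **Setting.** Fix the global frame $(\hat x_g,\hat y_g,\hat z_g)$ of $\mathbb R^3$, spherical coordinates $\omega(\theta,\phi)=(\sin\theta\cos\phi,\sin\theta\sin\phi,\cos\theta)$ on $S^2$, the solid angle measure $d\omega=\sin\theta\,d\theta\,d\phi$, and the $\theta\phi$-frame field $\mathbf F_{\theta\phi}(\omega)=[\hat\theta,\hat\phi,\omega]$. For $\omega\in S^2$ let $\mathcal S_\omega$ be the (4-dimensional real) Stokes space of rays along $\omega$: a Stokes vector $s$ has a component vector $[s]^{\mathbf F}\in\mathbb R^4$ with respect to every right-handed orthonormal frame $\mathbf F$ with third axis $\omega$; rotating the frame by $\vartheta$ about $\omega$ multiplies $(s_1,s_2)$ by $\begin{bmatrix}\cos2\vartheta&\sin2\vartheta\\-\sin2\vartheta&\cos2\vartheta\end{bmatrix}$ and fixes $s_0,s_3$. Write $[c]_{\mathbf F}$ for the Stokes vector with components $c$ in $\mathbf F$, $\langle s,t\rangle_{\mathcal S}=[s]^{\mathbf F}\cdot[t]^{\mathbf F}$, and $R_{\mathcal S}[c]_{\mathbf F}=[c]_{R\mathbf F}$ for $R\in SO(3)$. A pBRDF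 is a family $P(\omega_i,\omega_o)$ of $\mathbb R$-linear maps $\mathcal S_{\omega_i}\to\mathcal S_{\omega_o}$ ($\omega_i,\omega_o\in S^2$) whose Mueller matrix with respect to $\mathbf F_{\theta\phi}(\omega_i)\to\mathbf F_{\theta\phi}(\omega_o)$ has entries that are (measurable and) integrable on $S^2\times S^2$. It is *isotropic* (azimuthally symmetric) if $P(R\omega_i,R\omega_o)=R_{\mathcal S}\,P(\omega_i,\omega_o)\,R_{\mathcal S}^{-1}$ for all rotations $R$ about $\hat z_g$ and all $\omega_i,\omega_o$. Let $Y_{lm}$ be the complex spherical harmonics, $Y^R_{lm}$ the real ones, and, for $l\ge2$, $${}_2Y_{lm}=\sqrt{\tfrac{(l-2)!}{(l+2)!}}\,\bigl[\alpha_{lm}Y_{lm}+\beta_{lm}Y_{l-1,m}\bigr],$$ $$\alpha_{lm}(\theta)=\tfrac{2m^2-l(l+1)}{\sin^2\theta}-2m(l-1)\tfrac{\cot\theta}{\sin\theta}+l(l-1)\cot^2\theta,\qquad \beta_{lm}(\theta)=2\sqrt{\tfrac{2l+1}{2l-1}(l^2-m^2)}\Bigl(\tfrac{m}{\sin^2\theta}+\tfrac{\cot\theta}{\sin\theta}\Bigr)$$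 the spin-2 spherical harmonics. The polarized spherical harmonics (PSH) are the Stokes vector fields $\vec Y_{lmp}$ whose components in $\mathbf F_{\theta\phi}$ are $(Y^R_{lm},0,0,0)$, $(0,\Re\,{}_2Y_{lm},\Im\,{}_2Y_{lm},0)$, $(0,-\Im\,{}_2Y_{lm},\Re\,{}_2Y_{lm},0)$, $(0,0,0,Y^R_{lm})$ for $p=0,1,2,3$, with index set $I_{PSH}=\{(l,m,p): |m|\le l,\ 0\le p\le3,\ l\ge2\text{ if }p\in\{1,2\}\}$. The PSH coefficients of $P$ are $$\mathrm P_{l_om_op_o,l_im_ip_i}=\int_{S^2\times S^2}\bigl\langle \vec Y_{l_om_op_o}(\omega_o),P(\omega_i,\omega_o)\vec Y_{l_im_ip_i}(\omega_i)\bigr\rangle_{\mathcal S}\,d\omega_i\,d\omega_o .$$ For $M\in\mathbb R^{2\times2}$ put $\mathbb C_{iso}(M)=\frac{M_{11}+M_{22}}2+\frac{M_{21}-M_{12}}2i$ and $\mathbb C_{conj}(M)=\frac{M_{11}-M_{22}}2+\frac{M_{21}+M_{12}}2i$; let $\tilde P_{iso}(\omega_i,\omega_o)$, $\tilde P_{conj}(\omega_i,\omega_o)$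 be these two numbers for the rows and columns $1,2$ of the Mueller matrix of $P(\omega_i,\omega_o)$ in the $\theta\phi$-frames, and for $l_o,l_i\ge2$, $|m_o|\le l_o$, $|m_i|\le l_i$, $$\tilde{\mathrm P}_{l_om_o,l_im_i,iso}=\int_{S^2\times S^2}\tilde P_{iso}\;{}_2Y_{l_om_o}^*(\omega_o)\;{}_2Y_{l_im_i}(\omega_i)\,d\omega_i\,d\omega_o,\qquad \tilde{\mathrm P}_{l_om_o,l_im_i,conj}=\int_{S^2\times S^2}\tilde P_{conj}\;{}_2Y_{l_om_o}^*(\omega_o)\;{}_2Y_{l_im_i}^*(\omega_i)\,d\omega_i\,d\omega_o .$$ **Theorem.** (a) For every isotropic pBRDF $P$ and all $(l_o,m_o,p_o),(l_i,m_i,p_i)\in I_{PSH}$, $\mathrm P_{l_om_op_o,l_im_ip_i}=0$ if $|m_i|\ne|m_o|$. (b) For every isotropic pBRDF $P$ and all $l_o,l_i\ge 2$, $|m_o|\le l_o$, $|m_i|\le l_i$: $\tilde{\mathrm P}_{l_om_o,l_im_i,iso}=0$ if $m_i\ne m_o$, and $\tilde{\mathrm P}_{l_om_o,l_im_i,conj}=0$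 if $m_i\ne-m_o$. In the same cases the isomorphic part, respectively the conjugation part, of the spin 2-to-2 block $\bigl[\mathrm P_{l_om_op_o,l_im_ip_i}\bigr]_{p_o,p_i\in\{1,2\}}$ of the coefficient matrix vanishes. (c) The coefficient matrix up to order $l_i,l_o\le L$ has $\Theta(16L^4)$ (in particular $O(16L^4)$) entries. For every isotropic pBRDF all its nonzero entries lie among those with $|m_i|=|m_o|$, whose number (which does not depend on the pBRDF) is $O(16L^3)$ as $L\to\infty$. -/

import Mathlib

open MeasureTheory Filter Asymptotics
open scoped Matrix ComplexConjugate

noncomputable section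

namespace PSH

/-! ### Sphere, rotations, frames

Geometric vectors are written in a fixed global frame, so that the global frame is the standard
basis of `EuclideanSpace ℝ (Fin 3)` and `ẑ_g` is the third basis vector. -/

/-- The unit sphere of directions. -/
abbrev Sph : Type := Metric.sphere (0 : EuclideanSpace ℝ (Fin 3)) 1

/-- The solid angle measure `sin θ dθ dφ`: the surface measure, of total mass `4π`. -/
def solidAngle : Measure Sph := (volume : Measure (EuclideanSpace ℝ (Fin 3))).toSphere

/-- Rotation transforms, `SO(3)`. -/
abbrev Rotation : Type := Matrix.specialOrthogonalGroup (Fin 3) ℝ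

theorem Rotation.mul_transpose (R : Rotation) : R.1 * R.1ᵀ = 1 :=
  (Matrix.mem_orthogonalGroup_iff _ _).1 (Matrix.mem_specialOrthogonalGroup_iff.1 R.2).1

theorem Rotation.transpose_mul (R : Rotation) : R.1ᵀ * R.1 = 1 :=
  (Matrix.mem_orthogonalGroup_iff' _ _).1 (Matrix.mem_specialOrthogonalGroup_iff.1 R.2).1

/-- Rotation by `α` about the third axis. -/
def rotZ (α : ℝ) : Rotation :=
  ⟨!![Real.cos α, -Real.sin α, 0; Real.sin α, Real.cos α, 0; 0, 0, 1], by
    rw [Matrix.mem_specialOrthogonalGroup_iff, Matrix.mem_orthogonalGroup_iff]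
    constructor
    · ext i j
      fin_cases i <;> fin_cases j <;>
        simp [Matrix.mul_apply, Fin.sum_univ_three] <;>
        nlinarith [Real.sin_sq_add_cos_sq α]
    · simp [Matrix.det_fin_three]
      nlinarith [Real.sin_sq_add_cos_sq α]⟩

/-- Rotation by `θ` about the second axis. -/
def rotY (θ : ℝ) : Rotation :=
  ⟨!![Real.cos θ, 0, Real.sin θ; 0, 1, 0; -Real.sin θ, 0, Real.cos θ], by
    rw [Matrix.mem_specialOrthogonalGroup_iff, Matrix.mem_orthogonalGroup_iff]
    constructor
    · ext i j
      fin_cases i <;> fin_cases j <;>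
        simp [Matrix.mul_apply, Fin.sum_univ_three] <;>
        nlinarith [Real.sin_sq_add_cos_sq θ]
    · simp [Matrix.det_fin_three]
      nlinarith [Real.sin_sq_add_cos_sq θ]⟩

theorem sph_norm_sq (ω : Sph) : ω.1 0 ^ 2 + ω.1 1 ^ 2 + ω.1 2 ^ 2 = 1 := by
  have h : ‖ω.1‖ = 1 := by simp
  have h2 := EuclideanSpace.norm_sq_eq ω.1
  rw [h] at h2
  simp [Fin.sum_univ_three] at h2
  linarith

/-- The direction `R ω`. -/
def rotate (R : Rotation) (ω : Sph) : Sph :=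
  ⟨WithLp.toLp 2 (R.1 *ᵥ ω.1.ofLp), by
    have h : (R.1 *ᵥ ω.1.ofLp) ⬝ᵥ (R.1 *ᵥ ω.1.ofLp) = 1 := by
      rw [Matrix.dotProduct_mulVec, Matrix.vecMul_mulVec, Rotation.transpose_mul,
        Matrix.vecMul_one]
      have := sph_norm_sq ω
      simp only [dotProduct, Fin.sum_univ_three]
      linarith
    simp only [dotProduct, Fin.sum_univ_three] at h
    rw [mem_sphere_zero_iff_norm, EuclideanSpace.norm_eq, Real.sqrt_eq_one]
    simp only [Fin.sum_univ_three, Real.norm_eq_abs, sq_abs]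
    linarith⟩

/-- Local frames at `ω`: right-handed orthonormal frames (columns `x̂`, `ŷ`, `ẑ`) whose third axis
is `ω`. -/
def Frame (ω : Sph) : Type := {F : Rotation // ∀ i, F.1 i 2 = ω.1 i}

/-- The frame `R F`, a local frame at `R ω`. -/
def Frame.rotate {ω : Sph} (R : Rotation) (F : Frame ω) : Frame (PSH.rotate R ω) :=
  ⟨R * F.1, fun i => by
    simp [PSH.rotate, Matrix.mul_apply, Matrix.mulVec, dotProduct, F.2]⟩

/-- The frame `R⁻¹ G`, a local frame at `ω` when `G` is one at `R ω`. -/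
def Frame.unrotate {ω : Sph} (R : Rotation) (G : Frame (PSH.rotate R ω)) : Frame ω :=
  ⟨R⁻¹ * G.1, fun i => by
    have h : (fun k => G.1.1 k 2) = R.1 *ᵥ ω.1.ofLp := funext fun k => G.2 k
    have hR : (R⁻¹ : Rotation).1 * R.1 = 1 := congrArg Subtype.val (inv_mul_cancel R)
    have h1 : ((R⁻¹ : Rotation).1 * G.1.1) i 2
        = ((R⁻¹ : Rotation).1 *ᵥ (fun k => G.1.1 k 2)) i := rfl
    change ((R⁻¹ : Rotation).1 * G.1.1) i 2 = _
    rw [h1, h, Matrix.mulVec_mulVec, hR, Matrix.one_mulVec]⟩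

/-- The zenith angle of a direction. -/
def zenith (ω : Sph) : ℝ := Real.arccos (ω.1 2)

/-- The azimuth angle of a direction. -/
def azimuth (ω : Sph) : ℝ := Complex.arg ⟨ω.1 0, ω.1 1⟩

theorem sph_eq (ω : Sph) :
    ω.1 0 = Real.sin (zenith ω) * Real.cos (azimuth ω) ∧
    ω.1 1 = Real.sin (zenith ω) * Real.sin (azimuth ω) ∧ ω.1 2 = Real.cos (zenith ω) := by
  have h := sph_norm_sq ω
  have hs : Real.sin (zenith ω) = ‖(⟨ω.1 0, ω.1 1⟩ : ℂ)‖ := by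
    rw [zenith, Real.sin_arccos, Complex.norm_eq_sqrt_sq_add_sq]
    congr 1
    simp only
    linarith
  refine ⟨?_, ?_, ?_⟩
  · rw [hs, azimuth, Complex.norm_mul_cos_arg]
  · rw [hs, azimuth, Complex.norm_mul_sin_arg]
  · rw [zenith, Real.cos_arccos] <;> nlinarith [sq_nonneg (ω.1 0), sq_nonneg (ω.1 1)]

/-- The `θφ` frame at `ω`: its columns are `θ̂ = (cos θ cos φ, cos θ sin φ, -sin θ)`,
`φ̂ = (-sin φ, cos φ, 0)` and `ω`. (At the two poles, a null set, `φ = 0` is used.) -/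
def thetaPhiFrame (ω : Sph) : Frame ω :=
  ⟨rotZ (azimuth ω) * rotY (zenith ω), fun i => by
    obtain ⟨h0, h1, h2⟩ := sph_eq ω
    change ((rotZ (azimuth ω)).1 * (rotY (zenith ω)).1) i 2 = _
    fin_cases i <;>
      simp [rotZ, rotY, Matrix.mul_apply, Fin.sum_univ_three, h0, h1, h2] <;> ring⟩

/-! ### Stokes vectors and Mueller transforms -/

/-- Conversion of Stokes components under a rotation of the frame by `ϑ` about the ray. -/
def stokesConv (ϑ : ℝ) : Matrix (Fin 4) (Fin 4) ℝ :=
  !![1, 0, 0, 0;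
     0, Real.cos (2 * ϑ), Real.sin (2 * ϑ), 0;
     0, -Real.sin (2 * ϑ), Real.cos (2 * ϑ), 0;
     0, 0, 0, 1]

/-- The Stokes space of rays along `ω`. A Stokes vector (a class of pairs of components and frame)
is represented by the function which sends each local frame to its component vector with respect
to this frame; so `s F` is `[s]^F`. -/
def StokesSpace (ω : Sph) : Submodule ℝ (Frame ω → Fin 4 → ℝ) where
  carrier := {s | ∀ (F G : Frame ω) (ϑ : ℝ), G.1 = F.1 * rotZ ϑ → s G = stokesConv ϑ *ᵥ s F}
  add_mem' := by
    intro s t hs ht F G ϑ h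
    simp only [Pi.add_apply, Matrix.mulVec_add]
    rw [hs F G ϑ h, ht F G ϑ h]
  zero_mem' := by
    intro F G ϑ _
    simp
  smul_mem' := by
    intro c s hs F G ϑ h
    simp only [Pi.smul_apply, Matrix.mulVec_smul]
    rw [hs F G ϑ h]

theorem rotZ_add (a b : ℝ) : rotZ (a + b) = rotZ a * rotZ b := by
  apply Subtype.ext
  change (rotZ (a + b)).1 = (rotZ a).1 * (rotZ b).1
  ext i j
  fin_cases i <;> fin_cases j <;>
    simp [rotZ, Matrix.mul_apply, Fin.sum_univ_three, Real.cos_add, Real.sin_add] <;> ring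

theorem stokesConv_add (a b : ℝ) : stokesConv (a + b) = stokesConv b * stokesConv a := by
  ext i j
  fin_cases i <;> fin_cases j <;>
    simp [stokesConv, Matrix.mul_apply, Fin.sum_univ_four, mul_add, Real.cos_add,
      Real.sin_add] <;> ring

theorem stokesConv_congr {a b : ℝ} (h : rotZ a = rotZ b) : stokesConv a = stokesConv b := by
  have hm : (rotZ a).1 = (rotZ b).1 := congrArg Subtype.val h
  have hc : Real.cos a = Real.cos b := by simpa [rotZ] using congrFun (congrFun hm 0) 0
  have hs : Real.sin a = Real.sin b := by simpa [rotZ] using congrFun (congrFun hm 1) 0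
  simp only [stokesConv, Real.cos_two_mul, Real.sin_two_mul, hc, hs]

theorem stokesConv_zero : stokesConv 0 = 1 := by
  ext i j
  fin_cases i <;> fin_cases j <;> simp [stokesConv]

/-- Two local frames at the same direction differ by a rotation about the ray. -/
theorem Frame.exists_angle {ω : Sph} (F G : Frame ω) : ∃ ϑ : ℝ, G.1 = F.1 * rotZ ϑ := by
  obtain ⟨A, hA⟩ : ∃ A : Rotation, A = F.1⁻¹ * G.1 := ⟨_, rfl⟩
  have hF : (F.1⁻¹ : Rotation).1 * F.1.1 = 1 := congrArg Subtype.val (inv_mul_cancel F.1)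
  have hcol : ∀ i, A.1 i 2 = (1 : Matrix (Fin 3) (Fin 3) ℝ) i 2 := fun i => by
    rw [hA, ← hF]
    change ((F.1⁻¹ : Rotation).1 * G.1.1) i 2 = _
    simp only [Matrix.mul_apply, F.2, G.2]
  have h02 : A.1 0 2 = 0 := by simpa using hcol 0
  have h12 : A.1 1 2 = 0 := by simpa using hcol 1
  have h22 : A.1 2 2 = 1 := by simpa using hcol 2
  have hO := A.mul_transpose
  have e00 : A.1 0 0 ^ 2 + A.1 0 1 ^ 2 = 1 := by
    have := congrFun (congrFun hO 0) 0
    simp [Matrix.mul_apply, Fin.sum_univ_three, h02] at this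
    linarith
  have e11 : A.1 1 0 ^ 2 + A.1 1 1 ^ 2 = 1 := by
    have := congrFun (congrFun hO 1) 1
    simp [Matrix.mul_apply, Fin.sum_univ_three, h12] at this
    linarith
  have e22 : A.1 2 0 ^ 2 + A.1 2 1 ^ 2 = 0 := by
    have := congrFun (congrFun hO 2) 2
    simp [Matrix.mul_apply, Fin.sum_univ_three, h22] at this
    linarith
  have h20 : A.1 2 0 = 0 := by nlinarith [sq_nonneg (A.1 2 0), sq_nonneg (A.1 2 1)]
  have h21 : A.1 2 1 = 0 := by nlinarith [sq_nonneg (A.1 2 0), sq_nonneg (A.1 2 1)]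
  have hdet : A.1 0 0 * A.1 1 1 - A.1 0 1 * A.1 1 0 = 1 := by
    have := (Matrix.mem_specialOrthogonalGroup_iff.1 A.2).2
    rw [Matrix.det_fin_three, h02, h12, h22, h20, h21] at this
    linarith
  have hz : (A.1 0 0 - A.1 1 1) ^ 2 + (A.1 0 1 + A.1 1 0) ^ 2 = 0 := by nlinarith
  have h11 : A.1 1 1 = A.1 0 0 := by
    nlinarith [sq_nonneg (A.1 0 0 - A.1 1 1), sq_nonneg (A.1 0 1 + A.1 1 0)]
  have h01 : A.1 0 1 = -A.1 1 0 := by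
    nlinarith [sq_nonneg (A.1 0 0 - A.1 1 1), sq_nonneg (A.1 0 1 + A.1 1 0)]
  have hn : ‖(⟨A.1 0 0, A.1 1 0⟩ : ℂ)‖ = 1 := by
    rw [Complex.norm_eq_sqrt_sq_add_sq, Real.sqrt_eq_one]
    simp only
    nlinarith
  have hc := Complex.norm_mul_cos_arg (⟨A.1 0 0, A.1 1 0⟩ : ℂ)
  have hs := Complex.norm_mul_sin_arg (⟨A.1 0 0, A.1 1 0⟩ : ℂ)
  rw [hn, one_mul] at hc hs
  refine ⟨Complex.arg ⟨A.1 0 0, A.1 1 0⟩, ?_⟩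
  have hR : A = rotZ (Complex.arg ⟨A.1 0 0, A.1 1 0⟩) := by
    apply Subtype.ext
    ext i j
    fin_cases i <;> fin_cases j <;> simp [rotZ, hc, hs, h02, h12, h22, h20, h21, h11, h01]
  rw [← hR, hA, mul_inv_cancel_left]

/-- The angle by which `G` is rotated from `F` about the ray. -/
def Frame.angle {ω : Sph} (F G : Frame ω) : ℝ := (F.exists_angle G).choose

theorem Frame.angle_spec {ω : Sph} (F G : Frame ω) : G.1 = F.1 * rotZ (F.angle G) :=
  (F.exists_angle G).choose_spec

/-- The Stokes vector `[c]_F` with component vector `c` with respect to the frame `F`. -/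
def ofComponents {ω : Sph} (F : Frame ω) : (Fin 4 → ℝ) ≃ₗ[ℝ] StokesSpace ω where
  toFun c := ⟨fun G => stokesConv (F.angle G) *ᵥ c, fun G H ϑ h => by
    have h1 : rotZ (F.angle H) = rotZ (F.angle G + ϑ) := by
      apply mul_left_cancel (a := F.1)
      rw [rotZ_add, ← mul_assoc, ← Frame.angle_spec, ← Frame.angle_spec, h]
    simp only [Matrix.mulVec_mulVec]
    rw [stokesConv_congr h1, stokesConv_add]⟩
  map_add' c d := by
    apply Subtype.ext
    funext G
    exact Matrix.mulVec_add (stokesConv (F.angle G)) c d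
  map_smul' a c := by
    apply Subtype.ext
    funext G
    exact Matrix.mulVec_smul (stokesConv (F.angle G)) a c
  invFun s := s.1 F
  left_inv c := by
    have h : rotZ (F.angle F) = rotZ 0 := by
      apply mul_left_cancel (a := F.1)
      rw [← Frame.angle_spec]
      apply Subtype.ext
      change F.1.1 = F.1.1 * (rotZ 0).1
      have : (rotZ 0).1 = 1 := by
        ext i j
        fin_cases i <;> fin_cases j <;> simp [rotZ]
      rw [this, mul_one]
    simp [stokesConv_congr h, stokesConv_zero]
  right_inv s := by
    apply Subtype.ext
    funext G
    exact (s.2 F G _ (F.angle_spec G)).symm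

/-- The inner product of two Stokes vectors, by their components with respect to one frame. -/
def stokesInner {ω : Sph} (s t : StokesSpace ω) : ℝ :=
  s.1 (thetaPhiFrame ω) ⬝ᵥ t.1 (thetaPhiFrame ω)

/-- The inner product does not depend on the frame. -/
theorem stokesInner_eq {ω : Sph} (s t : StokesSpace ω) (F : Frame ω) :
    stokesInner s t = s.1 F ⬝ᵥ t.1 F := by
  have h := F.angle_spec (thetaPhiFrame ω)
  rw [stokesInner, s.2 _ _ _ h, t.2 _ _ _ h]
  simp only [stokesConv, Matrix.mulVec, dotProduct, Fin.sum_univ_four]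
  simp
  linear_combination (s.1 F 1 * t.1 F 1 + s.1 F 2 * t.1 F 2) *
    Real.sin_sq_add_cos_sq (2 * F.angle (thetaPhiFrame ω))

/-- The rotation `R_S` of Stokes vectors: `R_S [c]_F = [c]_{R F}`. -/
def rotateStokes (R : Rotation) (ω : Sph) : StokesSpace ω ≃ₗ[ℝ] StokesSpace (rotate R ω) where
  toFun s := ⟨fun G => s.1 (G.unrotate R), fun G H ϑ h => s.2 _ _ ϑ (by
    change R⁻¹ * H.1 = R⁻¹ * G.1 * rotZ ϑ
    rw [h, mul_assoc])⟩
  map_add' _ _ := rfl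
  map_smul' _ _ := rfl
  invFun t := ⟨fun F => t.1 (F.rotate R), fun F G ϑ h => t.2 _ _ ϑ (by
    change R * G.1 = R * F.1 * rotZ ϑ
    rw [h, mul_assoc])⟩
  left_inv s := by
    apply Subtype.ext
    funext F
    have h : (F.rotate R).unrotate R = F := Subtype.ext (inv_mul_cancel_left R F.1)
    change s.1 ((F.rotate R).unrotate R) = s.1 F
    rw [h]
  right_inv t := by
    apply Subtype.ext
    funext G
    have h : (G.unrotate R).rotate R = G := Subtype.ext (mul_inv_cancel_left R G.1)
    change t.1 ((G.unrotate R).rotate R) = t.1 G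
    rw [h]

/-- Mueller transforms from rays along `ωi` to rays along `ωo`. -/
abbrev Mueller (ωi ωo : Sph) : Type := StokesSpace ωi →ₗ[ℝ] StokesSpace ωo

/-- The Mueller matrix of `M` with respect to the frames `Fi` and `Fo`. -/
def muellerMatrix {ωi ωo : Sph} (M : Mueller ωi ωo) (Fi : Frame ωi) (Fo : Frame ωo) :
    Matrix (Fin 4) (Fin 4) ℝ :=
  LinearMap.toMatrix' ((ofComponents Fo).symm.toLinearMap ∘ₗ M ∘ₗ (ofComponents Fi).toLinearMap)

/-- The rotation of Mueller transforms, `R_M [M] = R_S M R_S⁻¹`. -/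
def rotateMueller (R : Rotation) {ωi ωo : Sph} (M : Mueller ωi ωo) :
    Mueller (rotate R ωi) (rotate R ωo) :=
  (rotateStokes R ωo).toLinearMap ∘ₗ M ∘ₗ (rotateStokes R ωi).symm.toLinearMap

/-- Mueller transform fields, i.e. (cosine-weighted) pBRDFs. -/
abbrev MuellerField : Type := (ωi ωo : Sph) → Mueller ωi ωo

/-- The Mueller matrix of a pBRDF with respect to the `θφ` frame field. -/
def MuellerField.matrix (P : MuellerField) (ωi ωo : Sph) : Matrix (Fin 4) (Fin 4) ℝ :=
  muellerMatrix (P ωi ωo) (thetaPhiFrame ωi) (thetaPhiFrame ωo)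

/-- The pBRDF is (measurable and) integrable over all pairs of directions. -/
def MuellerField.IsIntegrable (P : MuellerField) : Prop :=
  ∀ a b, Integrable (fun q : Sph × Sph => P.matrix q.1 q.2 a b) (solidAngle.prod solidAngle)

/-- Azimuthal symmetry (isotropy): invariance under all rotations about `ẑ_g`. -/
def MuellerField.IsIsotropic (P : MuellerField) : Prop :=
  ∀ (α : ℝ) (ωi ωo : Sph),
    P (rotate (rotZ α) ωi) (rotate (rotZ α) ωo) = rotateMueller (rotZ α) (P ωi ωo)

/-! ### Spherical harmonics -/

/-- The Legendre polynomial `P_l`, by Rodrigues' formula. -/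
def legendreP (l : ℕ) : Polynomial ℝ :=
  Polynomial.C (1 / (2 ^ l * (l.factorial : ℝ))) *
    Polynomial.derivative^[l] ((Polynomial.X ^ 2 - 1) ^ l)

/-- The associated Legendre function `P_l^m` for `m ≥ 0`. -/
def assocLegendreNonneg (l m : ℕ) (x : ℝ) : ℝ :=
  (-1) ^ m * Real.sqrt (1 - x ^ 2) ^ m * (Polynomial.derivative^[m] (legendreP l)).eval x

/-- The associated Legendre function `P_l^m` for `|m| ≤ l`. -/
def assocLegendre (l : ℕ) (m : ℤ) (x : ℝ) : ℝ :=
  if 0 ≤ m then assocLegendreNonneg l m.natAbs x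
  else (-1) ^ m.natAbs * (((l - m.natAbs).factorial : ℝ) / ((l + m.natAbs).factorial : ℝ)) *
    assocLegendreNonneg l m.natAbs x

/-- The spherical harmonic `Y_{lm}(θ, φ)`, `|m| ≤ l`. -/
def sphHarm (l : ℕ) (m : ℤ) (θ φ : ℝ) : ℂ :=
  (Real.sqrt ((2 * l + 1) / (4 * Real.pi) *
      ((((l : ℤ) - m).toNat.factorial : ℝ) / (((l : ℤ) + m).toNat.factorial : ℝ))) *
    assocLegendre l m (Real.cos θ) : ℝ) * Complex.exp (Complex.I * m * φ)

/-- The real spherical harmonic `Y^R_{lm}`. -/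
def realSphHarm (l : ℕ) (m : ℤ) (ω : Sph) : ℝ :=
  if 0 < m then Real.sqrt 2 * (sphHarm l m (zenith ω) (azimuth ω)).re
  else if m = 0 then (sphHarm l 0 (zenith ω) (azimuth ω)).re
  else Real.sqrt 2 * (sphHarm l |m| (zenith ω) (azimuth ω)).im

/-- The coefficient `α_{lm}(θ)` in the formula for the spin-2 spherical harmonics. -/
def spinAlpha (l : ℕ) (m : ℤ) (θ : ℝ) : ℝ :=
  (2 * (m : ℝ) ^ 2 - l * (l + 1)) / Real.sin θ ^ 2
    - 2 * m * (l - 1) * (Real.cot θ / Real.sin θ) + l * (l - 1) * Real.cot θ ^ 2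

/-- The coefficient `β_{lm}(θ)` in the formula for the spin-2 spherical harmonics. -/
def spinBeta (l : ℕ) (m : ℤ) (θ : ℝ) : ℝ :=
  2 * Real.sqrt ((2 * (l : ℝ) + 1) / (2 * l - 1) * ((l : ℝ) ^ 2 - (m : ℝ) ^ 2)) *
    (m / Real.sin θ ^ 2 + Real.cot θ / Real.sin θ)

/-- The spin-2 spherical harmonic `₂Y_{lm}` (`l ≥ 2`, `|m| ≤ l`), as complex Stokes components with
respect to the `θφ` frame field. (The values at the two poles, a null set, play no role.) -/
def spinSphHarm (l : ℕ) (m : ℤ) (ω : Sph) : ℂ :=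
  Real.sqrt (((l - 2).factorial : ℝ) / ((l + 2).factorial : ℝ)) *
    (spinAlpha l m (zenith ω) * sphHarm l m (zenith ω) (azimuth ω) +
      spinBeta l m (zenith ω) * sphHarm (l - 1) m (zenith ω) (azimuth ω))

/-- Components of the polarized spherical harmonics with respect to the `θφ` frame field. -/
def pshComponents (l : ℕ) (m : ℤ) (p : Fin 4) (ω : Sph) : Fin 4 → ℝ :=
  ![![realSphHarm l m ω, 0, 0, 0],
    ![0, (spinSphHarm l m ω).re, (spinSphHarm l m ω).im, 0],
    ![0, -(spinSphHarm l m ω).im, (spinSphHarm l m ω).re, 0],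
    ![0, 0, 0, realSphHarm l m ω]] p

/-- The polarized spherical harmonics, a family of Stokes vector fields. -/
def psh (l : ℕ) (m : ℤ) (p : Fin 4) (ω : Sph) : StokesSpace ω :=
  ofComponents (thetaPhiFrame ω) (pshComponents l m p ω)

/-- The index set of the polarized spherical harmonics. -/
def IsPSHIndex (l : ℕ) (m : ℤ) (p : Fin 4) : Prop :=
  |m| ≤ l ∧ (p = 1 ∨ p = 2 → 2 ≤ l)

/-- The PSH coefficient `P_{l_o m_o p_o, l_i m_i p_i}` of a pBRDF. -/
def pshCoeff (P : MuellerField) (lo : ℕ) (mo : ℤ) (po : Fin 4) (li : ℕ) (mi : ℤ) (pi : Fin 4) :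
    ℝ :=
  ∫ q : Sph × Sph, stokesInner (psh lo mo po q.2) (P q.1 q.2 (psh li mi pi q.1))
    ∂(solidAngle.prod solidAngle)

/-! ### Complex pair separation -/

/-- Isomorphic part of a real `2 × 2` matrix. -/
def isoPart (M : Matrix (Fin 2) (Fin 2) ℝ) : ℂ :=
  ⟨(M 0 0 + M 1 1) / 2, (M 1 0 - M 0 1) / 2⟩

/-- Conjugation part of a real `2 × 2` matrix. -/
def conjPart (M : Matrix (Fin 2) (Fin 2) ℝ) : ℂ :=
  ⟨(M 0 0 - M 1 1) / 2, (M 1 0 + M 0 1) / 2⟩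

/-- The spin 2-to-2 block of a Mueller matrix. -/
def spinBlock (M : Matrix (Fin 4) (Fin 4) ℝ) : Matrix (Fin 2) (Fin 2) ℝ :=
  !![M 1 1, M 1 2; M 2 1, M 2 2]

/-- The spin 2-to-2 block of the coefficient matrix for fixed orders and degrees. -/
def coeffBlock (P : MuellerField) (lo : ℕ) (mo : ℤ) (li : ℕ) (mi : ℤ) :
    Matrix (Fin 2) (Fin 2) ℝ :=
  spinBlock (Matrix.of fun po pi => pshCoeff P lo mo po li mi pi)

/-- The complex coefficient `P̃_{l_o m_o, l_i m_i, iso}`. -/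
def isoCoeff (P : MuellerField) (lo : ℕ) (mo : ℤ) (li : ℕ) (mi : ℤ) : ℂ :=
  ∫ q : Sph × Sph, isoPart (spinBlock (P.matrix q.1 q.2)) *
    conj (spinSphHarm lo mo q.2) * spinSphHarm li mi q.1 ∂(solidAngle.prod solidAngle)

/-- The complex coefficient `P̃_{l_o m_o, l_i m_i, conj}`. -/
def conjCoeff (P : MuellerField) (lo : ℕ) (mo : ℤ) (li : ℕ) (mi : ℤ) : ℂ :=
  ∫ q : Sph × Sph, conjPart (spinBlock (P.matrix q.1 q.2)) *
    conj (spinSphHarm lo mo q.2) * conj (spinSphHarm li mi q.1) ∂(solidAngle.prod solidAngle)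

/-! ### Storage -/

open Classical in
/-- The PSH indices `(l, m, p)` with `l ≤ L`. -/
def pshIndices (L : ℕ) : Finset (ℕ × ℤ × Fin 4) :=
  (Finset.range (L + 1) ×ˢ Finset.Icc (-(L : ℤ)) L ×ˢ Finset.univ).filter
    fun a => IsPSHIndex a.1 a.2.1 a.2.2

/-- All entries (output index, input index) of the coefficient matrix up to order `L`. -/
def allEntries (L : ℕ) : Finset ((ℕ × ℤ × Fin 4) × (ℕ × ℤ × Fin 4)) :=
  pshIndices L ×ˢ pshIndices L

/-- The entries that are stored for an isotropic pBRDF, those with `|m_i| = |m_o|`. -/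
def storedEntries (L : ℕ) : Finset ((ℕ × ℤ × Fin 4) × (ℕ × ℤ × Fin 4)) :=
  (allEntries L).filter fun e => |e.2.2.1| = |e.1.2.1|

end PSH

end

open PSH

namespace PSH

/-! ### Invariance of the solid angle measure -/

/-! The whole theorem is a change of variables. A rotation about the third axis preserves the solid
angle measure (`measurePreserving_rotate`) and, away from the poles, carries the `θφ` frame field to
itself (`thetaPhiFrame_rotate`). Hence the Mueller matrix of an isotropic field is unchanged when
both directions are rotated (`MuellerField.IsIsotropic.matrix_rotate`), and all dependence on the
angle `α` sits in the harmonics.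

A spin-2 harmonic is multiplied by `exp (I m α)`, so the integrand of a complex coefficient acquires
a phase of integer frequency `n`, namely `mi - mo` or `-(mi + mo)`. If `n ≠ 0`, the single angle `π
/ n` shows that the integral equals its negative (`integral_eq_zero_of_rotate`). A real PSH field
instead turns inside a plane spanned by itself and `pshPartner`. A real coefficient is then a
constant equal to a combination of products of cosines and sines of `mo α` and `mi α`, and averaging
over `α` makes it vanish if `|mi| ≠ |mo|` (`eq_zero_of_trig_eq_const`).

The analytic difficulty is that this expansion splits one integral into four, so each must converge.
The matrix entries being only integrable, the harmonics have to be bounded, although the formula for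
`spinSphHarm` contains `1 / sin² θ`. `exists_bound_spinNumerator` shows that the singularity
cancels; for `|m| ≤ 1` this rests on the values of Legendre polynomials and their derivatives at
`±1`.

The statements on 2-by-2 blocks follow since their two parts are the complex coefficients
(`isoPart_coeffBlock`, `conjPart_coeffBlock`). The counts rest on there being quadratically many
indices and, once the output index is fixed, only linearly many admissible input indices. -/

open scoped Pointwise in
-- The surface measure of a set is a multiple of the volume of the cone over it. Cones over
-- preimages are preimages of cones, and a linear isometry preserves volume.
theorem measurePreserving_toSphere {E : Type*} [NormedAddCommGroup E] [InnerProductSpace ℝ E]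
    [FiniteDimensional ℝ E] [MeasurableSpace E] [BorelSpace E] (T : E ≃ₗᵢ[ℝ] E)
    (f : Metric.sphere (0 : E) 1 → Metric.sphere (0 : E) 1) (hf : ∀ x, (f x : E) = T x) :
    MeasurePreserving f (volume : Measure E).toSphere (volume : Measure E).toSphere := by
  have hcont : Continuous f := by
    refine Continuous.subtype_mk (f := fun x => (f x : E)) ?_ _
    simp only [hf]
    exact T.continuous.comp continuous_subtype_val
  refine ⟨hcont.measurable, Measure.ext fun s hs => ?_⟩
  rw [Measure.map_apply hcont.measurable hs, Measure.toSphere_apply' _ (hcont.measurable hs),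
    Measure.toSphere_apply' _ hs]
  congr 1
  have h : Set.Ioo (0 : ℝ) 1 • ((↑) '' (f ⁻¹' s) : Set E)
      = T ⁻¹' (Set.Ioo (0 : ℝ) 1 • ((↑) '' s : Set E)) := by
    ext x
    simp only [Set.mem_smul, Set.mem_image, Set.mem_preimage]
    constructor
    · rintro ⟨r, hr, _, ⟨y, hy, rfl⟩, rfl⟩
      exact ⟨r, hr, f y, ⟨f y, hy, rfl⟩, by rw [hf, map_smul]⟩
    · rintro ⟨r, hr, _, ⟨y, hy, rfl⟩, hx⟩
      have hn : ‖T.symm (y : E)‖ = 1 := by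
        rw [LinearIsometryEquiv.norm_map]
        simp
      refine ⟨r, hr, T.symm y, ⟨⟨T.symm y, by simp [hn]⟩, ?_, rfl⟩, ?_⟩
      · have : f ⟨T.symm y, by simp [hn]⟩ = y := Subtype.ext (by rw [hf]; simp)
        change f _ ∈ s
        rw [this]
        exact hy
      · rw [← map_smul, hx]
        simp
  rw [h]
  exact T.measurePreserving.measure_preimage_emb
    T.toHomeomorph.measurableEmbedding _

/-- The linear isometry of `ℝ³` given by a rotation. -/
noncomputable def Rotation.isometry (R : Rotation) :
    EuclideanSpace ℝ (Fin 3) ≃ₗᵢ[ℝ] EuclideanSpace ℝ (Fin 3) :=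
  LinearIsometry.toLinearIsometryEquiv
    { toFun := fun v => WithLp.toLp 2 (R.1 *ᵥ v.ofLp)
      map_add' := fun v w => by
        simp [Matrix.mulVec_add]
      map_smul' := fun c v => by
        simp [Matrix.mulVec_smul]
      norm_map' := fun v => by
        have h : (R.1 *ᵥ v.ofLp) ⬝ᵥ (R.1 *ᵥ v.ofLp) = v.ofLp ⬝ᵥ v.ofLp := by
          rw [Matrix.dotProduct_mulVec, Matrix.vecMul_mulVec, Rotation.transpose_mul,
            Matrix.vecMul_one]
        simp only [dotProduct, ← sq] at h
        change ‖WithLp.toLp 2 (R.1 *ᵥ v.ofLp)‖ = ‖v‖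
        simp only [EuclideanSpace.norm_eq, Real.norm_eq_abs, sq_abs]
        rw [h] } rfl

theorem measurePreserving_rotate (R : Rotation) :
    MeasurePreserving (rotate R) solidAngle solidAngle :=
  measurePreserving_toSphere R.isometry (rotate R) fun _ => rfl

instance : IsFiniteMeasure solidAngle := by
  unfold solidAngle
  infer_instance

theorem measurePreserving_rotate_prod (R : Rotation) :
    MeasurePreserving (Prod.map (rotate R) (rotate R)) (solidAngle.prod solidAngle)
      (solidAngle.prod solidAngle) :=
  (measurePreserving_rotate R).prod (measurePreserving_rotate R)

theorem ae_sin_zenith_pos : ∀ᵐ ω ∂solidAngle, 0 < Real.sin (zenith ω) := by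
  have hmeas : MeasurableSet {ω : Sph | ω.1 0 = 0} := by
    refine measurableSet_eq_fun ?_ measurable_const
    fun_prop
  have h0 : solidAngle {ω : Sph | ω.1 0 = 0} = 0 := by
    rw [solidAngle, Measure.toSphere_apply' _ hmeas]
    -- The poles lie on the great circle `x = 0`, whose cone is contained in a proper subspace and
    -- so has volume zero.
    let S : Submodule ℝ (EuclideanSpace ℝ (Fin 3)) :=
      LinearMap.ker (EuclideanSpace.proj (𝕜 := ℝ) (0 : Fin 3)).toLinearMap
    have hS : S ≠ ⊤ := by
      intro h
      have : EuclideanSpace.single (0 : Fin 3) (1 : ℝ) ∈ S := h ▸ Submodule.mem_top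
      simp [S] at this
    refine mul_eq_zero_of_right _ (measure_mono_null ?_ (Measure.addHaar_submodule volume S hS))
    rintro _ ⟨r, -, _, ⟨y, hy, rfl⟩, rfl⟩
    simpa [S] using Or.inr hy
  have h1 : ∀ᵐ ω ∂solidAngle, ω.1 0 ≠ 0 := by
    rw [ae_iff]
    simpa using h0
  filter_upwards [h1] with ω hω
  have hs : 0 ≤ Real.sin (zenith ω) := by
    rw [zenith, Real.sin_arccos]
    exact Real.sqrt_nonneg _
  refine lt_of_le_of_ne hs fun h => hω ?_
  rw [(sph_eq ω).1, ← h, zero_mul]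

theorem ae_prod_sin_zenith_pos : ∀ᵐ q : Sph × Sph ∂(solidAngle.prod solidAngle),
    0 < Real.sin (zenith q.1) ∧ 0 < Real.sin (zenith q.2) :=
  (Measure.quasiMeasurePreserving_fst.ae ae_sin_zenith_pos).and
    (Measure.quasiMeasurePreserving_snd.ae ae_sin_zenith_pos)

/-! ### The `θφ` frame field under rotations about the third axis -/

theorem zenith_rotate_rotZ (α : ℝ) (ω : Sph) : zenith (rotate (rotZ α) ω) = zenith ω := by
  have : (rotate (rotZ α) ω).1 2 = ω.1 2 := by
    simp [rotate, rotZ, dotProduct, Fin.sum_univ_three]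
  rw [zenith, zenith, this]

/-- The azimuth is a principal argument, so a rotation shifts it by `α` only modulo `2π`. Cosine and
sine do not see the difference, and frames and integer-frequency exponentials depend on nothing
else. -/
theorem cos_sin_azimuth_rotate (α : ℝ) {ω : Sph} (hω : 0 < Real.sin (zenith ω)) :
    Real.cos (azimuth (rotate (rotZ α) ω)) = Real.cos (α + azimuth ω) ∧
    Real.sin (azimuth (rotate (rotZ α) ω)) = Real.sin (α + azimuth ω) := by
  obtain ⟨h0, h1, -⟩ := sph_eq ω
  obtain ⟨g0, g1, -⟩ := sph_eq (rotate (rotZ α) ω)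
  have e0 : (rotate (rotZ α) ω).1 0 = Real.cos α * ω.1 0 - Real.sin α * ω.1 1 := by
    simp [rotate, rotZ, dotProduct, Fin.sum_univ_three]
    ring
  have e1 : (rotate (rotZ α) ω).1 1 = Real.sin α * ω.1 0 + Real.cos α * ω.1 1 := by
    simp [rotate, rotZ, dotProduct, Fin.sum_univ_three]
  rw [zenith_rotate_rotZ] at g0 g1
  constructor
  · apply mul_left_cancel₀ hω.ne'
    rw [← g0, e0, h0, h1, Real.cos_add]
    ring
  · apply mul_left_cancel₀ hω.ne'
    rw [← g1, e1, h0, h1, Real.sin_add]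
    ring

theorem exp_azimuth_rotate (α : ℝ) {ω : Sph} (hω : 0 < Real.sin (zenith ω)) (m : ℤ) :
    Complex.exp (Complex.I * m * azimuth (rotate (rotZ α) ω))
      = Complex.exp (Complex.I * m * α) * Complex.exp (Complex.I * m * azimuth ω) := by
  obtain ⟨hc, hs⟩ := cos_sin_azimuth_rotate α hω
  have h : Complex.exp (Complex.I * azimuth (rotate (rotZ α) ω))
      = Complex.exp (Complex.I * α) * Complex.exp (Complex.I * azimuth ω) := by
    rw [← Complex.exp_add, ← mul_add, ← Complex.ofReal_add, mul_comm, mul_comm Complex.I,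
      Complex.exp_mul_I, Complex.exp_mul_I]
    norm_cast
    rw [hc, hs]
  have e : ∀ x : ℝ, Complex.exp (Complex.I * m * x) = Complex.exp (Complex.I * x) ^ m := by
    intro x
    rw [← Complex.exp_int_mul]
    congr 1
    ring
  rw [e, e, e, h, mul_zpow]

theorem thetaPhiFrame_rotate (α : ℝ) {ω : Sph} (hω : 0 < Real.sin (zenith ω)) :
    thetaPhiFrame (rotate (rotZ α) ω) = (thetaPhiFrame ω).rotate (rotZ α) := by
  obtain ⟨hc, hs⟩ := cos_sin_azimuth_rotate α hω
  have h : rotZ (azimuth (rotate (rotZ α) ω)) = rotZ (α + azimuth ω) := by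
    generalize azimuth (rotate (rotZ α) ω) = β at hc hs ⊢
    exact Subtype.ext (by simp only [rotZ, hc, hs])
  apply Subtype.ext
  change rotZ _ * rotY _ = rotZ α * (rotZ _ * rotY _)
  rw [h, zenith_rotate_rotZ, rotZ_add, mul_assoc]

/-! ### Mueller matrices -/

theorem ofComponents_apply_self {ω : Sph} (F : Frame ω) (c : Fin 4 → ℝ) :
    (ofComponents F c).1 F = c :=
  (ofComponents F).symm_apply_apply c

theorem muellerMatrix_mulVec {ωi ωo : Sph} (M : Mueller ωi ωo) (Fi : Frame ωi) (Fo : Frame ωo)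
    (c : Fin 4 → ℝ) : muellerMatrix M Fi Fo *ᵥ c = (M (ofComponents Fi c)).1 Fo := by
  rw [muellerMatrix, ← Matrix.toLin'_apply, Matrix.toLin'_toMatrix']
  rfl

theorem rotateStokes_ofComponents (R : Rotation) {ω : Sph} (F : Frame ω) (c : Fin 4 → ℝ) :
    rotateStokes R ω (ofComponents F c) = ofComponents (F.rotate R) c := by
  apply (ofComponents (F.rotate R)).symm.injective
  rw [LinearEquiv.symm_apply_apply]
  change (ofComponents F c).1 ((F.rotate R).unrotate R) = c
  have h : (F.rotate R).unrotate R = F := Subtype.ext (inv_mul_cancel_left R F.1)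
  rw [h, ofComponents_apply_self]

theorem muellerMatrix_rotateMueller (R : Rotation) {ωi ωo : Sph} (M : Mueller ωi ωo)
    (Fi : Frame ωi) (Fo : Frame ωo) :
    muellerMatrix (rotateMueller R M) (Fi.rotate R) (Fo.rotate R) = muellerMatrix M Fi Fo := by
  apply Matrix.toLin'.injective
  ext1 c
  refine LinearMap.ext fun x => ?_
  simp only [LinearMap.comp_apply, Matrix.toLin'_apply]
  rw [muellerMatrix_mulVec, muellerMatrix_mulVec, ← rotateStokes_ofComponents]
  change (rotateStokes R ωo (M ((rotateStokes R ωi).symm (rotateStokes R ωi _)))).1 _ = _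
  rw [LinearEquiv.symm_apply_apply]
  change (M _).1 ((Fo.rotate R).unrotate R) = _
  have h : (Fo.rotate R).unrotate R = Fo := Subtype.ext (inv_mul_cancel_left R Fo.1)
  rw [h]

theorem MuellerField.IsIsotropic.matrix_rotate {P : MuellerField} (hP : P.IsIsotropic) (α : ℝ)
    {ωi ωo : Sph} (hi : 0 < Real.sin (zenith ωi)) (ho : 0 < Real.sin (zenith ωo)) :
    P.matrix (rotate (rotZ α) ωi) (rotate (rotZ α) ωo) = P.matrix ωi ωo := by
  rw [MuellerField.matrix, thetaPhiFrame_rotate α hi, thetaPhiFrame_rotate α ho, hP,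
    muellerMatrix_rotateMueller]
  rfl

theorem pshCoeff_eq_integral (P : MuellerField) (lo : ℕ) (mo : ℤ) (po : Fin 4) (li : ℕ) (mi : ℤ)
    (pi : Fin 4) :
    pshCoeff P lo mo po li mi pi = ∫ q : Sph × Sph, pshComponents lo mo po q.2 ⬝ᵥ
      (P.matrix q.1 q.2 *ᵥ pshComponents li mi pi q.1) ∂(solidAngle.prod solidAngle) := by
  unfold pshCoeff
  congr 1
  funext q
  rw [stokesInner, psh, ofComponents_apply_self, MuellerField.matrix, muellerMatrix_mulVec, psh]

/-! ### Boundary values of Legendre polynomials -/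

open Polynomial in
theorem iterate_derivative_comp_linear {R : Type*} [CommRing R] (p : R[X]) (a : R) (q : R[X])
    (hq : derivative q = C a) (n : ℕ) :
    derivative^[n] (p.comp q) = C (a ^ n) * (derivative^[n] p).comp q := by
  induction n with
  | zero => simp
  | succ n ih =>
    rw [Function.iterate_succ_apply', ih, Function.iterate_succ_apply', derivative_C_mul,
      derivative_comp, hq, pow_succ, C_mul]
    ring

open Polynomial in
-- The substitution `t = (1 - x) / 2` moves `x = 1` to `t = 0`, where values and derivatives of
-- `shiftedLegendre` are read off its explicit coefficients.
theorem legendreP_eq_comp (l : ℕ) :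
    legendreP l = ((shiftedLegendre l).map (Int.castRingHom ℝ)).comp (C (1 / 2) * (1 - X)) := by
  have hf : (l.factorial : ℝ) ≠ 0 := Nat.cast_ne_zero.2 l.factorial_ne_zero
  have h1 : (C (l.factorial : ℝ)) * (shiftedLegendre l).map (Int.castRingHom ℝ)
      = derivative^[l] (X ^ l * (1 - X) ^ l) := by
    have := congrArg (Polynomial.map (Int.castRingHom ℝ)) (factorial_mul_shiftedLegendre_eq l)
    rw [← iterate_derivative_map] at this
    simpa using this
  have h2 := iterate_derivative_comp_linear (X ^ l * (1 - X) ^ l : ℝ[X]) (-1 / 2)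
    (C (1 / 2) * (1 - X)) (by
      simp only [derivative_C_mul, derivative_sub, derivative_one, derivative_X, zero_sub,
        mul_neg, mul_one, neg_div, C_neg]) l
  -- With `t = (1 - x) / 2` one has `t (1 - t) = -(x² - 1) / 4`, which matches the two Rodrigues
  -- formulas.
  have h3 : ((X ^ l * (1 - X) ^ l : ℝ[X])).comp (C (1 / 2) * (1 - X))
      = C ((-1 / 4) ^ l) * (X ^ 2 - 1) ^ l := by
    simp only [mul_comp, pow_comp, X_comp, sub_comp, one_comp, C_pow, ← mul_pow]
    congr 1
    have e : (1 : ℝ[X]) = C (1 / 2) + C (1 / 2) := by rw [← C_add]; norm_num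
    have e4 : (C (-1 / 4) : ℝ[X]) = -(C (1 / 2) * C (1 / 2)) := by
      rw [← C_mul, ← C_neg]; norm_num
    have e' : (1 : ℝ[X]) - C (1 / 2) * (1 - X) = C (1 / 2) * (1 + X) := by
      linear_combination e
    rw [e', e4]
    ring
  rw [h3, iterate_derivative_C_mul, ← h1, mul_comp, C_comp] at h2
  have h4 : C ((-1 / 2 : ℝ) ^ l * l.factorial) * legendreP l = C ((-1 / 2 : ℝ) ^ l * l.factorial) *
      ((shiftedLegendre l).map (Int.castRingHom ℝ)).comp (C (1 / 2) * (1 - X)) := by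
    rw [C_mul, mul_assoc, mul_assoc, ← h2, legendreP, ← mul_assoc (C _) (C _), ← C_mul,
      ← mul_assoc, ← C_mul]
    congr 2
    have e : (-1 / 4 : ℝ) = -1 / 2 * (1 / 2) := by norm_num
    rw [e, mul_pow, one_div_pow]
    field_simp
  refine mul_left_cancel₀ ?_ h4
  rw [Ne, C_eq_zero]
  exact mul_ne_zero (pow_ne_zero _ (by norm_num)) hf

open Polynomial in
theorem legendreP_eval_one (l : ℕ) : (legendreP l).eval 1 = 1 := by
  rw [legendreP_eq_comp, eval_comp]
  simp [← coeff_zero_eq_eval_zero, coeff_shiftedLegendre]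

open Polynomial in
theorem legendreP_derivative_eval_one (l : ℕ) :
    (derivative (legendreP l)).eval 1 = l * (l + 1) / 2 := by
  have h : (derivative ((shiftedLegendre l).map (Int.castRingHom ℝ))).eval 0
      = -(l * (l + 1)) := by
    rw [← coeff_zero_eq_eval_zero, coeff_derivative, coeff_map, coeff_shiftedLegendre]
    simp
  rw [legendreP_eq_comp, derivative_comp, eval_mul, eval_comp]
  simp only [derivative_C_mul, derivative_sub, derivative_one, derivative_X, eval_mul, eval_C,
    eval_sub, eval_zero, eval_one, eval_X, sub_self, mul_zero, h]
  ring

open Polynomial in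
-- The symmetry `t ↦ 1 - t` of the shifted polynomial becomes parity in `x`; it transfers the data
-- at `1` to `-1`.
theorem legendreP_comp_neg (l : ℕ) : (legendreP l).comp (-X) = C ((-1) ^ l) * legendreP l := by
  refine Polynomial.funext fun x => ?_
  have h := shiftedLegendre_eval_symm l ((1 + x) / 2)
  simp only [aeval_def, ← eval_map, algebraMap_int_eq] at h
  rw [eval_comp, eval_mul, eval_C, legendreP_eq_comp, eval_comp, eval_comp]
  simp only [eval_mul, eval_C, eval_sub, eval_one, eval_X, eval_neg]
  convert! h using 2
  · ring_nf
  · ring_nf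

open Polynomial in
theorem legendreP_eval_neg_one (l : ℕ) : (legendreP l).eval (-1) = (-1) ^ l := by
  have h := congrArg (eval 1) (legendreP_comp_neg l)
  simpa [eval_comp, legendreP_eval_one] using h

open Polynomial in
theorem legendreP_derivative_eval_neg_one (l : ℕ) :
    (derivative (legendreP l)).eval (-1) = -(-1) ^ l * (l * (l + 1) / 2) := by
  have h := congrArg (fun p => eval 1 (derivative p)) (legendreP_comp_neg l)
  simp only [derivative_comp, derivative_C_mul, eval_mul, eval_C, eval_comp, eval_neg,
    eval_X, derivative_neg, derivative_X, eval_one, legendreP_derivative_eval_one] at h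
  linarith

/-! ### Boundedness of the harmonics -/

theorem exists_bound_eval (p : Polynomial ℝ) : ∃ C, ∀ θ : ℝ, |p.eval (Real.cos θ)| ≤ C := by
  obtain ⟨C, hC⟩ := isCompact_Icc.exists_bound_of_continuousOn
    (p.continuous.continuousOn (s := Set.Icc (-1 : ℝ) 1))
  exact ⟨C, fun θ => hC _ ⟨Real.neg_one_le_cos θ, Real.cos_le_one θ⟩⟩

theorem one_sub_sq_dvd {p : Polynomial ℝ} (h1 : p.eval 1 = 0) (h2 : p.eval (-1) = 0) :
    (1 - Polynomial.X ^ 2) ∣ p := by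
  obtain ⟨q, rfl⟩ := Polynomial.dvd_iff_isRoot.2 h1
  rw [Polynomial.eval_mul] at h2
  have h3 : q.eval (-1) = 0 := by
    refine (mul_eq_zero.1 h2).resolve_left ?_
    simp
    norm_num
  obtain ⟨r, rfl⟩ := Polynomial.dvd_iff_isRoot.2 h3
  exact ⟨-r, by simp; ring⟩

/-- The constant `κ` in `P_l^m(cos θ) = κ (sin θ)^|m| P_l^(|m|)(cos θ)`. -/
noncomputable def legendreSign (l : ℕ) (m : ℤ) : ℝ :=
  if 0 ≤ m then (-1) ^ m.natAbs
  else ((l - m.natAbs).factorial : ℝ) / ((l + m.natAbs).factorial : ℝ)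

theorem assocLegendre_cos (l : ℕ) (m : ℤ) {θ : ℝ} (hθ : 0 ≤ Real.sin θ) :
    assocLegendre l m (Real.cos θ) = legendreSign l m * Real.sin θ ^ m.natAbs *
      (Polynomial.derivative^[m.natAbs] (legendreP l)).eval (Real.cos θ) := by
  have hs : Real.sqrt (1 - Real.cos θ ^ 2) = Real.sin θ := by
    rw [← Real.sin_sq, Real.sqrt_sq hθ]
  have h1 : ((-1 : ℝ) ^ m.natAbs) * (-1) ^ m.natAbs = 1 := by
    rw [← mul_pow]
    norm_num
  unfold assocLegendre assocLegendreNonneg legendreSign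
  rw [hs]
  split_ifs
  · rfl
  · linear_combination (((l - m.natAbs).factorial : ℝ) / ((l + m.natAbs).factorial : ℝ)) *
      Real.sin θ ^ m.natAbs *
      (Polynomial.derivative^[m.natAbs] (legendreP l)).eval (Real.cos θ) * h1

/-- The normalization constant of `Y_{lm}`. -/
noncomputable def sphHarmNorm (l : ℕ) (m : ℤ) : ℝ :=
  Real.sqrt ((2 * l + 1) / (4 * Real.pi) *
      ((((l : ℤ) - m).toNat.factorial : ℝ) / (((l : ℤ) + m).toNat.factorial : ℝ)))

theorem sphHarm_eq (l : ℕ) (m : ℤ) (θ φ : ℝ) :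
    sphHarm l m θ φ = ((sphHarmNorm l m * assocLegendre l m (Real.cos θ) : ℝ) : ℂ) *
      Complex.exp (Complex.I * m * φ) := rfl

theorem norm_exp_I_mul_int (m : ℤ) (φ : ℝ) : ‖Complex.exp (Complex.I * m * φ)‖ = 1 := by
  rw [Complex.norm_exp]
  simp

/-- The square root in `spinBeta` is exactly what turns the normalization of degree `k` into that of
degree `k + 1`. Both terms of `spinNumerator` then share one constant and can cancel. -/
theorem sqrt_mul_sphHarmNorm (k : ℕ) (m : ℤ) (hm : |m| ≤ k) :
    Real.sqrt ((2 * ((k + 1 : ℕ) : ℝ) + 1) / (2 * ((k + 1 : ℕ) : ℝ) - 1) *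
      (((k + 1 : ℕ) : ℝ) ^ 2 - (m : ℝ) ^ 2)) * sphHarmNorm k m
      = (k + 1 + m) * sphHarmNorm (k + 1) m := by
  obtain ⟨h1, h2⟩ := abs_le.1 hm
  obtain ⟨p, hp⟩ := Int.eq_ofNat_of_zero_le (show 0 ≤ (k : ℤ) - m by lia)
  obtain ⟨q, hq⟩ := Int.eq_ofNat_of_zero_le (show 0 ≤ (k : ℤ) + m by lia)
  have ep : (((k + 1 : ℕ) : ℤ) - m).toNat = p + 1 := by lia
  have eq : (((k + 1 : ℕ) : ℤ) + m).toNat = q + 1 := by lia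
  have hpR : (k : ℝ) - m = p := by exact_mod_cast hp
  have hqR : (k : ℝ) + m = q := by exact_mod_cast hq
  have hnn : (0 : ℝ) ≤ k + 1 + m := by
    rw [add_right_comm, hqR]
    positivity
  rw [sphHarmNorm, sphHarmNorm, ep, eq, hp, hq, Int.toNat_natCast, Int.toNat_natCast,
    Nat.factorial_succ, Nat.factorial_succ, ← Real.sqrt_mul' _ (by positivity)]
  rw [← abs_of_nonneg hnn, ← Real.sqrt_sq_eq_abs, ← Real.sqrt_mul (sq_nonneg _)]
  congr 1
  have hq' : (q : ℝ) + 1 = k + 1 + m := by linarith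
  have hp' : (p : ℝ) + 1 = k + 1 - m := by linarith
  push_cast
  rw [hq', hp']
  have h0 : (k : ℝ) + 1 + m ≠ 0 := by
    rw [← hq']
    positivity
  have h3 : 2 * ((k : ℝ) + 1) - 1 ≠ 0 := by
    have : (0 : ℝ) ≤ k := by positivity
    intro h
    linarith
  have h4 := Nat.cast_ne_zero (R := ℝ).2 q.factorial_ne_zero
  field_simp
  ring

open Polynomial in
/-- The numerator of `₂Y_{lm}` as a multiple of `(sin θ)^(|m|-2)`, with `l = k + 1`. -/
noncomputable def spinNumerator (k : ℕ) (m : ℤ) : ℝ[X] :=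
  C (sphHarmNorm (k + 1) m * legendreSign (k + 1) m) *
      (C (2 * (m : ℝ) ^ 2 - (k + 1) * (k + 2)) - C (2 * (m : ℝ) * k) * X
        + C (((k : ℝ) + 1) * k) * X ^ 2) * derivative^[m.natAbs] (legendreP (k + 1)) +
    C (2 * Real.sqrt ((2 * ((k + 1 : ℕ) : ℝ) + 1) / (2 * ((k + 1 : ℕ) : ℝ) - 1) *
        (((k + 1 : ℕ) : ℝ) ^ 2 - (m : ℝ) ^ 2)) * sphHarmNorm k m * legendreSign k m) *
      (C (m : ℝ) + X) * derivative^[m.natAbs] (legendreP k)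

theorem spinNumerator_eval (k : ℕ) (m : ℤ) {θ : ℝ} (hθ : 0 < Real.sin θ) :
    spinAlpha (k + 1) m θ * (sphHarmNorm (k + 1) m * assocLegendre (k + 1) m (Real.cos θ)) +
      spinBeta (k + 1) m θ * (sphHarmNorm k m * assocLegendre k m (Real.cos θ))
      = Real.sin θ ^ m.natAbs * (spinNumerator k m).eval (Real.cos θ) / Real.sin θ ^ 2 := by
  rw [assocLegendre_cos _ _ hθ.le, assocLegendre_cos _ _ hθ.le, spinAlpha, spinBeta,
    spinNumerator, Real.cot_eq_cos_div_sin]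
  simp only [Polynomial.eval_add, Polynomial.eval_sub, Polynomial.eval_mul, Polynomial.eval_C,
    Polynomial.eval_pow, Polynomial.eval_X]
  generalize Real.sqrt _ = b
  push_cast
  field_simp
  ring

/-- After the common normalization is factored out, only `P_l(±1)` (for `m = 0`) or `P_l'(±1)` (for
`m = ±1`) enter, and the two terms cancel. For `m = ±1`, at the endpoint `-m` both prefactors
already vanish. -/
theorem spinNumerator_eval_boundary (k : ℕ) (hk : 1 ≤ k) (m : ℤ) (hm : m.natAbs ≤ 1) :
    (spinNumerator k m).eval 1 = 0 ∧ (spinNumerator k m).eval (-1) = 0 := by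
  have hmk : |m| ≤ k := by
    rw [Int.abs_eq_natAbs]
    exact_mod_cast hm.trans hk
  have hk0 : (k : ℝ) ≠ 0 := by
    rw [Nat.cast_ne_zero]
    lia
  have hc := sqrt_mul_sphHarmNorm k m hmk
  have hm' : m = 0 ∨ m = 1 ∨ m = -1 := by lia
  unfold spinNumerator
  rw [mul_assoc 2 (Real.sqrt _), hc]
  simp only [Polynomial.eval_add, Polynomial.eval_sub, Polynomial.eval_mul, Polynomial.eval_C,
    Polynomial.eval_pow, Polynomial.eval_X]
  generalize sphHarmNorm (k + 1) m = N
  -- These expand the factorial quotients that `legendreSign` contributes when `m = -1`.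
  have f1 : ((k + 2).factorial : ℝ) = (k + 2) * (k + 1) * k.factorial := by
    rw [Nat.factorial_succ, Nat.factorial_succ]
    push_cast
    ring
  have f2 : ((k + 1).factorial : ℝ) = (k + 1) * k * (k - 1).factorial := by
    obtain ⟨j, rfl⟩ : ∃ j, k = j + 1 := ⟨k - 1, by lia⟩
    rw [Nat.factorial_succ, Nat.factorial_succ, Nat.add_sub_cancel]
    push_cast
    ring
  have hf1 := Nat.cast_ne_zero (R := ℝ).2 k.factorial_ne_zero
  have hf2 := Nat.cast_ne_zero (R := ℝ).2 (k - 1).factorial_ne_zero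
  rcases hm' with rfl | rfl | rfl
  · simp [legendreSign, legendreP_eval_one, legendreP_eval_neg_one]
    constructor <;> ring
  · simp [legendreSign, legendreP_derivative_eval_one, legendreP_derivative_eval_neg_one,
      -mul_eq_zero]
    constructor <;> ring
  · simp [legendreSign, legendreP_derivative_eval_one, legendreP_derivative_eval_neg_one,
      add_assoc, -mul_eq_zero]
    norm_num [f1, f2, -mul_eq_zero]
    constructor <;> field_simp <;> ring

theorem exists_bound_spinNumerator (k : ℕ) (hk : 1 ≤ k) (m : ℤ) :
    ∃ C, ∀ θ : ℝ, 0 < Real.sin θ →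
      |Real.sin θ ^ m.natAbs * (spinNumerator k m).eval (Real.cos θ) / Real.sin θ ^ 2| ≤ C := by
  have key : ∀ (p : Polynomial ℝ) (n : ℕ), ∃ C, ∀ θ : ℝ,
      |Real.sin θ ^ n * p.eval (Real.cos θ)| ≤ C := by
    intro p n
    obtain ⟨C, hC⟩ := exists_bound_eval p
    refine ⟨C, fun θ => ?_⟩
    rw [abs_mul, abs_pow]
    exact (mul_le_of_le_one_left (abs_nonneg _)
      (pow_le_one₀ (abs_nonneg _) (Real.abs_sin_le_one θ))).trans (hC θ)
  -- For `|m| ≥ 2` the factor `sin^|m|` absorbs the denominator. For `|m| ≤ 1` the polynomial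
  -- vanishes at `±1`, so it is divisible by `1 - X²`, which is `sin²` at `cos θ`.
  rcases le_or_gt m.natAbs 1 with hm | hm
  · obtain ⟨h1, h2⟩ := spinNumerator_eval_boundary k hk m hm
    obtain ⟨q, hq⟩ := one_sub_sq_dvd h1 h2
    obtain ⟨C, hC⟩ := key q m.natAbs
    refine ⟨C, fun θ hθ => ?_⟩
    convert hC θ using 2
    rw [hq]
    simp only [Polynomial.eval_mul, Polynomial.eval_sub, Polynomial.eval_one,
      Polynomial.eval_pow, Polynomial.eval_X, ← Real.sin_sq]
    field_simp
  · obtain ⟨C, hC⟩ := key (spinNumerator k m) (m.natAbs - 2)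
    refine ⟨C, fun θ hθ => ?_⟩
    convert hC θ using 2
    obtain ⟨n, hn⟩ : ∃ n, m.natAbs = n + 2 := ⟨m.natAbs - 2, by lia⟩
    rw [hn, Nat.add_sub_cancel, pow_add]
    field_simp

theorem exists_bound_sphHarm (l : ℕ) (m : ℤ) :
    ∃ C, ∀ θ φ : ℝ, 0 < Real.sin θ → ‖sphHarm l m θ φ‖ ≤ C := by
  obtain ⟨C, hC⟩ := exists_bound_eval (Polynomial.derivative^[m.natAbs] (legendreP l))
  refine ⟨|sphHarmNorm l m * legendreSign l m| * C, fun θ φ hθ => ?_⟩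
  rw [sphHarm_eq, norm_mul, norm_exp_I_mul_int, mul_one, Complex.norm_real,
    assocLegendre_cos _ _ hθ.le, ← mul_assoc, ← mul_assoc, mul_right_comm, Real.norm_eq_abs,
    abs_mul, abs_mul _ (Polynomial.eval _ _), abs_pow, mul_assoc]
  refine mul_le_mul_of_nonneg_left ?_ (abs_nonneg _)
  exact (mul_le_of_le_one_right (abs_nonneg _)
    (pow_le_one₀ (abs_nonneg _) (Real.abs_sin_le_one θ))).trans (hC θ)

theorem exists_bound_spinSphHarm (l : ℕ) (hl : 2 ≤ l) (m : ℤ) :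
    ∃ C, ∀ ω : Sph, 0 < Real.sin (zenith ω) → ‖spinSphHarm l m ω‖ ≤ C := by
  obtain ⟨k, rfl⟩ : ∃ k, l = k + 1 := ⟨l - 1, by lia⟩
  obtain ⟨C, hC⟩ := exists_bound_spinNumerator k (by lia) m
  refine ⟨|Real.sqrt (((k + 1 - 2).factorial : ℝ) / ((k + 1 + 2).factorial : ℝ))| * C,
    fun ω hω => ?_⟩
  rw [spinSphHarm, norm_mul, Complex.norm_real, Real.norm_eq_abs]
  refine mul_le_mul_of_nonneg_left ?_ (abs_nonneg _)
  have h := hC _ hω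
  rw [← spinNumerator_eval k m hω] at h
  rw [Nat.add_sub_cancel, sphHarm_eq, sphHarm_eq, ← mul_assoc, ← mul_assoc, ← add_mul, norm_mul,
    norm_exp_I_mul_int, mul_one]
  norm_cast

/-! ### Measurability of the harmonics -/

theorem measurable_zenith : Measurable zenith := by
  unfold zenith
  refine Real.continuous_arccos.measurable.comp ?_
  fun_prop

theorem measurable_azimuth : Measurable azimuth := by
  unfold azimuth
  refine Complex.measurable_arg.comp ?_
  have h : (fun ω : Sph => (⟨ω.1 0, ω.1 1⟩ : ℂ)) =
      fun ω => (ω.1 0 : ℂ) + (ω.1 1 : ℂ) * Complex.I := by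
    funext ω
    exact Complex.mk_eq_add_mul_I _ _
  rw [h]
  fun_prop

theorem measurable_assocLegendre (l : ℕ) (m : ℤ) : Measurable (assocLegendre l m) := by
  have h : Continuous (assocLegendreNonneg l m.natAbs) := by
    unfold assocLegendreNonneg
    fun_prop
  unfold assocLegendre
  split_ifs
  · exact h.measurable
  · exact h.measurable.const_mul _

theorem measurable_sphHarm (l : ℕ) (m : ℤ) :
    Measurable fun ω : Sph => sphHarm l m (zenith ω) (azimuth ω) := by
  simp only [sphHarm_eq]
  have h1 := measurable_zenith
  have h2 := measurable_azimuth
  have h3 := measurable_assocLegendre l m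
  fun_prop

theorem measurable_spinSphHarm (l : ℕ) (m : ℤ) : Measurable (spinSphHarm l m) := by
  have h1 := measurable_zenith
  have h2 := measurable_sphHarm l m
  have h3 := measurable_sphHarm (l - 1) m
  unfold spinSphHarm spinAlpha spinBeta
  simp only [Real.cot_eq_cos_div_sin]
  fun_prop

theorem measurable_realSphHarm (l : ℕ) (m : ℤ) : Measurable (realSphHarm l m) := by
  unfold realSphHarm
  split_ifs
  · exact (Complex.measurable_re.comp (measurable_sphHarm l m)).const_mul _
  · exact Complex.measurable_re.comp (measurable_sphHarm l 0)
  · exact (Complex.measurable_im.comp (measurable_sphHarm l |m|)).const_mul _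

/-! ### Harmonics under rotations about the third axis -/

theorem exp_I_mul_int_mul_real (m : ℤ) (α : ℝ) :
    Complex.exp (Complex.I * m * α)
      = (Real.cos (m * α) : ℂ) + (Real.sin (m * α) : ℂ) * Complex.I := by
  rw [Complex.ofReal_cos, Complex.ofReal_sin, ← Complex.exp_mul_I]
  congr 1
  push_cast
  ring

theorem sphHarm_rotate (l : ℕ) (m : ℤ) (α : ℝ) {ω : Sph} (hω : 0 < Real.sin (zenith ω)) :
    sphHarm l m (zenith (rotate (rotZ α) ω)) (azimuth (rotate (rotZ α) ω))
      = Complex.exp (Complex.I * m * α) * sphHarm l m (zenith ω) (azimuth ω) := by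
  rw [sphHarm_eq, sphHarm_eq, exp_azimuth_rotate α hω, zenith_rotate_rotZ]
  ring

theorem spinSphHarm_rotate (l : ℕ) (m : ℤ) (α : ℝ) {ω : Sph} (hω : 0 < Real.sin (zenith ω)) :
    spinSphHarm l m (rotate (rotZ α) ω)
      = Complex.exp (Complex.I * m * α) * spinSphHarm l m ω := by
  rw [spinSphHarm, spinSphHarm, sphHarm_rotate l m α hω, sphHarm_rotate (l - 1) m α hω,
    zenith_rotate_rotZ]
  ring

/-- Up to the factor `√2`, degrees `m` and `-m` are the real and imaginary parts of one complex
harmonic, so a phase mixes them. For `m = 0` the sine is zero. -/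
theorem realSphHarm_rotate (l : ℕ) (m : ℤ) (α : ℝ) {ω : Sph} (hω : 0 < Real.sin (zenith ω)) :
    realSphHarm l m (rotate (rotZ α) ω)
      = Real.cos (m * α) * realSphHarm l m ω - Real.sin (m * α) * realSphHarm l (-m) ω := by
  unfold realSphHarm
  rcases lt_trichotomy m 0 with hm | rfl | hm
  · have h1 : ¬0 < m := by lia
    have h2 : m ≠ 0 := by lia
    have h3 : 0 < -m := by lia
    rw [if_neg h1, if_neg h2, if_pos h3, if_neg h1, if_neg h2, abs_of_neg hm,
      sphHarm_rotate l (-m) α hω, exp_I_mul_int_mul_real]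
    simp [-Complex.ofReal_cos, -Complex.ofReal_sin]
    ring
  · simp [sphHarm_rotate l 0 α hω]
  · have h1 : ¬0 < -m := by lia
    have h2 : -m ≠ 0 := by lia
    rw [if_pos hm, if_pos hm, if_neg h1, if_neg h2, abs_neg, abs_of_pos hm,
      sphHarm_rotate l m α hω, exp_I_mul_int_mul_real]
    simp [-Complex.ofReal_cos, -Complex.ofReal_sin]
    ring

/-- The components of the field which completes `psh l m p` to a plane invariant under the
rotations about the third axis. -/
noncomputable def pshPartner (l : ℕ) (m : ℤ) (p : Fin 4) (ω : Sph) : Fin 4 → ℝ :=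
  ![-pshComponents l (-m) 0 ω, pshComponents l m 2 ω, -pshComponents l m 1 ω,
    -pshComponents l (-m) 3 ω] p

/-- For `p = 1, 2` the partner is the field multiplied by `i`, which swaps `p` and keeps `m`; for `p
= 0, 3` it comes from degree `-m`. -/
theorem pshComponents_rotate (l : ℕ) (m : ℤ) (p : Fin 4) (α : ℝ) {ω : Sph}
    (hω : 0 < Real.sin (zenith ω)) :
    pshComponents l m p (rotate (rotZ α) ω)
      = Real.cos (m * α) • pshComponents l m p ω + Real.sin (m * α) • pshPartner l m p ω := by
  have h1 := realSphHarm_rotate l m α hω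
  have h2 : spinSphHarm l m (rotate (rotZ α) ω) = _ := spinSphHarm_rotate l m α hω
  rw [exp_I_mul_int_mul_real] at h2
  ext a
  fin_cases p <;> fin_cases a <;>
    simp [pshComponents, pshPartner, h1, h2, -Complex.ofReal_cos, -Complex.ofReal_sin] <;> ring

/-! ### Integrability against bounded fields -/

/-- Almost everywhere bounded and measurable component fields. -/
def IsBoundedField (c : Sph → Fin 4 → ℝ) : Prop :=
  Measurable c ∧ ∃ C, ∀ ω, 0 < Real.sin (zenith ω) → ∀ a, |c ω a| ≤ C

theorem IsBoundedField.neg {c : Sph → Fin 4 → ℝ} (hc : IsBoundedField c) :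
    IsBoundedField fun ω => -c ω := by
  obtain ⟨hm, C, hC⟩ := hc
  exact ⟨hm.neg, C, fun ω hω a => by simpa using hC ω hω a⟩

theorem exists_bound_realSphHarm (l : ℕ) (m : ℤ) :
    ∃ C, ∀ ω : Sph, 0 < Real.sin (zenith ω) → |realSphHarm l m ω| ≤ C := by
  have h2 : |Real.sqrt 2| = Real.sqrt 2 := abs_of_nonneg (Real.sqrt_nonneg _)
  unfold realSphHarm
  split_ifs
  · obtain ⟨C, hC⟩ := exists_bound_sphHarm l m
    refine ⟨Real.sqrt 2 * C, fun ω hω => ?_⟩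
    rw [abs_mul, h2]
    exact mul_le_mul_of_nonneg_left ((Complex.abs_re_le_norm _).trans (hC _ _ hω))
      (Real.sqrt_nonneg _)
  · obtain ⟨C, hC⟩ := exists_bound_sphHarm l 0
    exact ⟨C, fun ω hω => (Complex.abs_re_le_norm _).trans (hC _ _ hω)⟩
  · obtain ⟨C, hC⟩ := exists_bound_sphHarm l |m|
    refine ⟨Real.sqrt 2 * C, fun ω hω => ?_⟩
    rw [abs_mul, h2]
    exact mul_le_mul_of_nonneg_left ((Complex.abs_im_le_norm _).trans (hC _ _ hω))
      (Real.sqrt_nonneg _)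

theorem isBoundedField_pshComponents {l : ℕ} {m : ℤ} {p : Fin 4} (h : p = 1 ∨ p = 2 → 2 ≤ l) :
    IsBoundedField (pshComponents l m p) := by
  have hY := measurable_realSphHarm l m
  have hre := Complex.measurable_re.comp (measurable_spinSphHarm l m)
  have him := Complex.measurable_im.comp (measurable_spinSphHarm l m)
  constructor
  · refine measurable_pi_lambda _ fun a => ?_
    fin_cases p <;> fin_cases a <;> simp [pshComponents] <;>
      first | exact hY | exact hre | exact him
  · by_cases hp : p = 1 ∨ p = 2
    · obtain ⟨C, hC⟩ := exists_bound_spinSphHarm l (h hp) m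
      refine ⟨C, fun ω hω a => ?_⟩
      have h0 : 0 ≤ C := (norm_nonneg _).trans (hC ω hω)
      have h1 := (Complex.abs_re_le_norm _).trans (hC ω hω)
      have h2 := (Complex.abs_im_le_norm _).trans (hC ω hω)
      rcases hp with rfl | rfl <;> fin_cases a <;> simp [pshComponents, h0, h1, h2]
    · obtain ⟨C, hC⟩ := exists_bound_realSphHarm l m
      refine ⟨C, fun ω hω a => ?_⟩
      have h1 := hC ω hω
      have h0 : 0 ≤ C := (abs_nonneg _).trans h1
      fin_cases p <;> simp at hp <;> fin_cases a <;> simp [pshComponents, h0, h1]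

theorem isBoundedField_pshPartner {l : ℕ} {m : ℤ} {p : Fin 4} (h : p = 1 ∨ p = 2 → 2 ≤ l) :
    IsBoundedField (pshPartner l m p) := by
  fin_cases p
  · exact (isBoundedField_pshComponents (l := l) (m := -m) (p := 0) (by simp)).neg
  · exact isBoundedField_pshComponents (l := l) (m := m) (p := 2) fun _ => h (by simp)
  · exact (isBoundedField_pshComponents (l := l) (m := m) (p := 1) fun _ => h (by simp)).neg
  · exact (isBoundedField_pshComponents (l := l) (m := -m) (p := 3) (by simp)).neg

/-- The function of pairs of directions whose integral is the coefficient of `P` with respect to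
the fields with components `c` and `d`. -/
noncomputable def pairing (P : MuellerField) (c d : Sph → Fin 4 → ℝ) (q : Sph × Sph) : ℝ :=
  c q.2 ⬝ᵥ (P.matrix q.1 q.2 *ᵥ d q.1)

theorem integrable_pairing {P : MuellerField} (hP : P.IsIntegrable) {c d : Sph → Fin 4 → ℝ}
    (hc : IsBoundedField c) (hd : IsBoundedField d) :
    Integrable (pairing P c d) (solidAngle.prod solidAngle) := by
  obtain ⟨mc, C, hC⟩ := hc
  obtain ⟨md, D, hD⟩ := hd
  unfold pairing dotProduct Matrix.mulVec dotProduct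
  refine integrable_finsetSum _ fun a _ => ?_
  refine Integrable.bdd_mul (c := C) ?_ ?_ ?_
  · refine integrable_finsetSum _ fun b _ => ?_
    refine Integrable.mul_bdd (c := D) (hP a b) ?_ ?_
    · exact ((measurable_pi_iff.1 md b).comp measurable_fst).aestronglyMeasurable
    · filter_upwards [ae_prod_sin_zenith_pos] with q hq
      exact hD _ hq.1 b
  · exact ((measurable_pi_iff.1 mc a).comp measurable_snd).aestronglyMeasurable
  · filter_upwards [ae_prod_sin_zenith_pos] with q hq
    exact hC _ hq.2 a

/-! ### Vanishing coefficients -/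

/-- A rotation is a measurable equivalence, so no regularity of `f` is needed. -/
theorem integral_rotate {E : Type*} [NormedAddCommGroup E] [NormedSpace ℝ E] (R : Rotation)
    (f : Sph × Sph → E) :
    ∫ q, f (rotate R q.1, rotate R q.2) ∂(solidAngle.prod solidAngle)
      = ∫ q, f q ∂(solidAngle.prod solidAngle) := by
  have hcont : ∀ S : Rotation, Measurable (rotate S) := fun S =>
    (measurePreserving_rotate S).measurable
  have hcancel : ∀ (S T : Rotation), S * T = 1 → ∀ ω, rotate S (rotate T ω) = ω := by
    intro S T h ω
    have h' : S.1 * T.1 = 1 := congrArg Subtype.val h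
    apply Subtype.ext
    simp [rotate, h']
  let e : Sph ≃ᵐ Sph :=
    { toFun := rotate R
      invFun := rotate R⁻¹
      left_inv := hcancel _ _ (inv_mul_cancel R)
      right_inv := hcancel _ _ (mul_inv_cancel R)
      measurable_toFun := hcont R
      measurable_invFun := hcont R⁻¹ }
  exact (measurePreserving_rotate_prod R).integral_comp (e.prodCongr e).measurableEmbedding f

theorem integral_cos_int_mul {n : ℤ} (hn : n ≠ 0) :
    ∫ x in (0 : ℝ)..(2 * Real.pi), Real.cos (n * x) = 0 := by
  have h : (n : ℝ) ≠ 0 := Int.cast_ne_zero.2 hn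
  rw [intervalIntegral.integral_comp_mul_left _ h, integral_cos]
  have : (n : ℝ) * (2 * Real.pi) = ((2 * n : ℤ) : ℝ) * Real.pi := by
    push_cast
    ring
  rw [this, Real.sin_int_mul_pi]
  simp

/-- A trigonometric form with nonzero frequencies only is constant only if it vanishes. -/
theorem eq_zero_of_trig_eq_const {a b : ℤ} (hab : |b| ≠ |a|) {A B C D : ℝ}
    (h : ∀ x : ℝ, Real.cos (a * x) * (Real.cos (b * x) * A + Real.sin (b * x) * B) +
      Real.sin (a * x) * (Real.cos (b * x) * C + Real.sin (b * x) * D) = A) : A = 0 := by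
  have h1 : a - b ≠ 0 := fun e => hab (by rw [sub_eq_zero.1 e])
  have h2 : a + b ≠ 0 := fun e => hab (by rw [eq_neg_of_add_eq_zero_left e, abs_neg])
  -- Averaging the identity at `x` and `-x` removes the `B` and `C` terms; the rest has frequencies
  -- `a ± b`, both nonzero, and integrates to zero over a period.
  have key : ∀ x : ℝ, (A + D) / 2 * Real.cos ((a - b : ℤ) * x)
      + (A - D) / 2 * Real.cos ((a + b : ℤ) * x) = A := by
    intro x
    have e1 := h x
    have e2 := h (-x)
    simp only [mul_neg, Real.cos_neg, Real.sin_neg] at e2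
    push_cast
    rw [sub_mul, add_mul, Real.cos_sub, Real.cos_add]
    linear_combination (e1 + e2) / 2
  have hi : ∫ x in (0 : ℝ)..(2 * Real.pi), ((A + D) / 2 * Real.cos ((a - b : ℤ) * x)
      + (A - D) / 2 * Real.cos ((a + b : ℤ) * x)) = ∫ x in (0 : ℝ)..(2 * Real.pi), A :=
    intervalIntegral.integral_congr fun x _ => key x
  rw [intervalIntegral.integral_add (Continuous.intervalIntegrable (by fun_prop) _ _)
    (Continuous.intervalIntegrable (by fun_prop) _ _), intervalIntegral.integral_const_mul,
    intervalIntegral.integral_const_mul, integral_cos_int_mul h1, integral_cos_int_mul h2] at hi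
  simpa [Real.pi_ne_zero] using hi

theorem pshCoeff_eq_zero {P : MuellerField} (hI : P.IsIntegrable) (hP : P.IsIsotropic) {lo : ℕ}
    {mo : ℤ} {po : Fin 4} {li : ℕ} {mi : ℤ} {pi : Fin 4} (ho : IsPSHIndex lo mo po)
    (hi : IsPSHIndex li mi pi) (hm : |mi| ≠ |mo|) : pshCoeff P lo mo po li mi pi = 0 := by
  have bc := isBoundedField_pshComponents (m := mo) ho.2
  have bc' := isBoundedField_pshPartner (m := mo) ho.2
  have bd := isBoundedField_pshComponents (m := mi) hi.2
  have bd' := isBoundedField_pshPartner (m := mi) hi.2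
  set c := pshComponents lo mo po with hc
  set c' := pshPartner lo mo po
  set d := pshComponents li mi pi with hd
  set d' := pshPartner li mi pi
  have e : pshCoeff P lo mo po li mi pi = ∫ q, pairing P c d q ∂(solidAngle.prod solidAngle) :=
    pshCoeff_eq_integral ..
  have i1 := integrable_pairing hI bc bd
  have i2 := integrable_pairing hI bc bd'
  have i3 := integrable_pairing hI bc' bd
  have i4 := integrable_pairing hI bc' bd'
  rw [e]
  refine eq_zero_of_trig_eq_const (B := ∫ q, pairing P c d' q ∂(solidAngle.prod solidAngle))
    (C := ∫ q, pairing P c' d q ∂(solidAngle.prod solidAngle))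
    (D := ∫ q, pairing P c' d' q ∂(solidAngle.prod solidAngle)) hm fun x => ?_
  -- The trigonometric form is the coefficient computed after rotating both directions by `x`, hence
  -- constant in `x`.
  refine Eq.trans ?_ (integral_rotate (rotZ x) (pairing P c d))
  rw [← integral_const_mul, ← integral_const_mul,
    ← integral_add (i1.const_mul _) (i2.const_mul _), ← integral_const_mul, ← integral_const_mul,
    ← integral_const_mul, ← integral_add (i3.const_mul _) (i4.const_mul _), ← integral_const_mul]
  refine (integral_add (((i1.const_mul _).add (i2.const_mul _)).const_mul _)
    (((i3.const_mul _).add (i4.const_mul _)).const_mul _)).symm.trans ?_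
  refine integral_congr_ae ?_
  filter_upwards [ae_prod_sin_zenith_pos] with q hq
  simp only [pairing, Pi.add_apply]
  rw [hP.matrix_rotate x hq.1 hq.2, hc, pshComponents_rotate lo mo po x hq.2, hd,
    pshComponents_rotate li mi pi x hq.1]
  simp only [Matrix.mulVec_add, Matrix.mulVec_smul, add_dotProduct, dotProduct_add,
    smul_dotProduct, dotProduct_smul, smul_eq_mul, c', d']
  ring

theorem integral_eq_zero_of_rotate {n : ℤ} (hn : n ≠ 0) {f : Sph × Sph → ℂ}
    (hf : ∀ (α : ℝ) (q : Sph × Sph), 0 < Real.sin (zenith q.1) → 0 < Real.sin (zenith q.2) →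
      f (rotate (rotZ α) q.1, rotate (rotZ α) q.2) = Complex.exp (Complex.I * n * α) * f q) :
    ∫ q, f q ∂(solidAngle.prod solidAngle) = 0 := by
  -- At this angle the phase is `exp (π I) = -1`. Nothing is split, so `f` need not be integrable.
  have h := integral_rotate (rotZ (Real.pi / n)) f
  have h1 : ∫ q, f (rotate (rotZ (Real.pi / n)) q.1, rotate (rotZ (Real.pi / n)) q.2)
      ∂(solidAngle.prod solidAngle) = ∫ q, -f q ∂(solidAngle.prod solidAngle) := by
    refine integral_congr_ae ?_
    filter_upwards [ae_prod_sin_zenith_pos] with q hq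
    rw [hf _ q hq.1 hq.2]
    have hn' : (n : ℂ) ≠ 0 := Int.cast_ne_zero.2 hn
    have e : Complex.I * n * ((Real.pi / n : ℝ) : ℂ) = Real.pi * Complex.I := by
      push_cast
      field_simp
    rw [e, Complex.exp_pi_mul_I, neg_one_mul]
  rw [h1, integral_neg] at h
  exact self_eq_neg.1 h.symm

theorem isoCoeff_eq_zero {P : MuellerField} (hP : P.IsIsotropic) (lo : ℕ) {mo : ℤ} (li : ℕ)
    {mi : ℤ} (hm : mi ≠ mo) : isoCoeff P lo mo li mi = 0 := by
  refine integral_eq_zero_of_rotate (sub_ne_zero.2 hm) fun α q h1 h2 => ?_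
  rw [hP.matrix_rotate α h1 h2, spinSphHarm_rotate lo mo α h2, spinSphHarm_rotate li mi α h1,
    map_mul, ← Complex.exp_conj]
  simp only [map_mul, Complex.conj_I, Complex.conj_ofReal, map_intCast]
  have e : Complex.exp (Complex.I * (mi - mo : ℤ) * α)
      = Complex.exp (-Complex.I * mo * α) * Complex.exp (Complex.I * mi * α) := by
    rw [← Complex.exp_add]
    congr 1
    push_cast
    ring
  rw [e]
  ring

theorem conjCoeff_eq_zero {P : MuellerField} (hP : P.IsIsotropic) (lo : ℕ) {mo : ℤ} (li : ℕ)
    {mi : ℤ} (hm : mi ≠ -mo) : conjCoeff P lo mo li mi = 0 := by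
  have hn : -(mi + mo) ≠ 0 := fun h => hm (by lia)
  refine integral_eq_zero_of_rotate hn fun α q h1 h2 => ?_
  rw [hP.matrix_rotate α h1 h2, spinSphHarm_rotate lo mo α h2, spinSphHarm_rotate li mi α h1,
    map_mul, map_mul, ← Complex.exp_conj, ← Complex.exp_conj]
  simp only [map_mul, Complex.conj_I, Complex.conj_ofReal, map_intCast]
  have e : Complex.exp (Complex.I * (-(mi + mo) : ℤ) * α)
      = Complex.exp (-Complex.I * mo * α) * Complex.exp (-Complex.I * mi * α) := by
    rw [← Complex.exp_add]
    congr 1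
    push_cast
    ring
  rw [e]
  ring

/-! ### Complex pair separation of the coefficient matrix -/

theorem isoPart_eq (M : Matrix (Fin 2) (Fin 2) ℝ) : isoPart M
    = (((M 0 0 + M 1 1) / 2 : ℝ) : ℂ) + (((M 1 0 - M 0 1) / 2 : ℝ) : ℂ) * Complex.I :=
  Complex.mk_eq_add_mul_I _ _

theorem conjPart_eq (M : Matrix (Fin 2) (Fin 2) ℝ) : conjPart M
    = (((M 0 0 - M 1 1) / 2 : ℝ) : ℂ) + (((M 1 0 + M 0 1) / 2 : ℝ) : ℂ) * Complex.I :=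
  Complex.mk_eq_add_mul_I _ _

theorem integral_add_mul_I {α : Type*} [MeasurableSpace α] {μ : Measure α} {u v : α → ℝ}
    (hu : Integrable u μ) (hv : Integrable v μ) :
    ∫ q, ((u q : ℂ) + (v q : ℂ) * Complex.I) ∂μ
      = ((∫ q, u q ∂μ : ℝ) : ℂ) + ((∫ q, v q ∂μ : ℝ) : ℂ) * Complex.I := by
  rw [integral_add hu.ofReal (hv.ofReal.mul_const _), integral_mul_const,
    integral_complex_ofReal, integral_complex_ofReal]

/-- The block of integrands of the spin 2-to-2 coefficients. -/
noncomputable def pairingBlock (P : MuellerField) (lo : ℕ) (mo : ℤ) (li : ℕ) (mi : ℤ)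
    (q : Sph × Sph) : Matrix (Fin 2) (Fin 2) ℝ :=
  spinBlock (Matrix.of fun po pi =>
    pairing P (pshComponents lo mo po) (pshComponents li mi pi) q)

/-- A real 2-by-2 matrix acts on `ℂ` as `z ↦ a z + b z̄`, with `a` its isomorphic and `b` its
conjugation part. The block is this map preceded by multiplication by the input harmonic and
followed by multiplication by the conjugate output harmonic. The input harmonic is therefore
conjugated only in the `b` term. -/
theorem isoPart_pairingBlock (P : MuellerField) (lo : ℕ) (mo : ℤ) (li : ℕ) (mi : ℤ)
    (q : Sph × Sph) : isoPart (pairingBlock P lo mo li mi q)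
      = isoPart (spinBlock (P.matrix q.1 q.2)) * conj (spinSphHarm lo mo q.2) *
        spinSphHarm li mi q.1 := by
  apply Complex.ext <;>
    simp [isoPart, pairingBlock, spinBlock, pairing, pshComponents, dotProduct, Matrix.mulVec,
      Fin.sum_univ_four] <;>
    ring

theorem conjPart_pairingBlock (P : MuellerField) (lo : ℕ) (mo : ℤ) (li : ℕ) (mi : ℤ)
    (q : Sph × Sph) : conjPart (pairingBlock P lo mo li mi q)
      = conjPart (spinBlock (P.matrix q.1 q.2)) * conj (spinSphHarm lo mo q.2) *
        conj (spinSphHarm li mi q.1) := by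
  apply Complex.ext <;>
    simp [conjPart, pairingBlock, spinBlock, pairing, pshComponents, dotProduct, Matrix.mulVec,
      Fin.sum_univ_four] <;>
    ring

theorem integrable_pairingBlock {P : MuellerField} (hI : P.IsIntegrable) {lo li : ℕ}
    (ho : 2 ≤ lo) (hi : 2 ≤ li) (mo mi : ℤ) (a b : Fin 2) :
    Integrable (fun q => pairingBlock P lo mo li mi q a b) (solidAngle.prod solidAngle) := by
  have h := fun po pi : Fin 4 => integrable_pairing hI
    (isBoundedField_pshComponents (m := mo) (p := po) fun _ => ho)
    (isBoundedField_pshComponents (m := mi) (p := pi) fun _ => hi)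
  fin_cases a <;> fin_cases b <;> exact h _ _

theorem coeffBlock_eq_integral (P : MuellerField) (lo : ℕ) (mo : ℤ) (li : ℕ) (mi : ℤ)
    (a b : Fin 2) : coeffBlock P lo mo li mi a b
      = ∫ q, pairingBlock P lo mo li mi q a b ∂(solidAngle.prod solidAngle) := by
  fin_cases a <;> fin_cases b <;> exact pshCoeff_eq_integral ..

theorem isoPart_coeffBlock {P : MuellerField} (hI : P.IsIntegrable) {lo li : ℕ} (ho : 2 ≤ lo)
    (hi : 2 ≤ li) (mo mi : ℤ) : isoPart (coeffBlock P lo mo li mi) = isoCoeff P lo mo li mi := by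
  have h := integrable_pairingBlock hI ho hi mo mi
  have e : ∀ q, _ = _ := fun q =>
    (isoPart_pairingBlock P lo mo li mi q).symm.trans (isoPart_eq _)
  unfold isoCoeff
  simp only [e]
  refine Eq.trans ?_ (integral_add_mul_I (((h 0 0).add (h 1 1)).div_const 2)
    (((h 1 0).sub (h 0 1)).div_const 2)).symm
  rw [isoPart_eq, integral_div, integral_div, integral_add' (h 0 0) (h 1 1),
    integral_sub' (h 1 0) (h 0 1)]
  simp only [coeffBlock_eq_integral]

theorem conjPart_coeffBlock {P : MuellerField} (hI : P.IsIntegrable) {lo li : ℕ} (ho : 2 ≤ lo)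
    (hi : 2 ≤ li) (mo mi : ℤ) :
    conjPart (coeffBlock P lo mo li mi) = conjCoeff P lo mo li mi := by
  have h := integrable_pairingBlock hI ho hi mo mi
  have e : ∀ q, _ = _ := fun q =>
    (conjPart_pairingBlock P lo mo li mi q).symm.trans (conjPart_eq _)
  unfold conjCoeff
  simp only [e]
  refine Eq.trans ?_ (integral_add_mul_I (((h 0 0).sub (h 1 1)).div_const 2)
    (((h 1 0).add (h 0 1)).div_const 2)).symm
  rw [conjPart_eq, integral_div, integral_div, integral_sub' (h 0 0) (h 1 1),
    integral_add' (h 1 0) (h 0 1)]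
  simp only [coeffBlock_eq_integral]

/-! ### Counting entries -/

theorem mem_pshIndices {L : ℕ} {a : ℕ × ℤ × Fin 4} :
    a ∈ pshIndices L ↔ a.1 ≤ L ∧ IsPSHIndex a.1 a.2.1 a.2.2 := by
  simp only [pshIndices, Finset.mem_filter, Finset.mem_product, Finset.mem_range, Finset.mem_Icc,
    Finset.mem_univ, and_true]
  constructor
  · rintro ⟨⟨h1, -⟩, h2⟩
    exact ⟨by lia, h2⟩
  · rintro ⟨h1, h2⟩
    have := abs_le.1 h2.1
    exact ⟨⟨by lia, by lia, by lia⟩, h2⟩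

theorem card_pshIndices_le (L : ℕ) : (pshIndices L).card ≤ (L + 1) * ((2 * L + 1) * 4) := by
  classical
  unfold pshIndices
  refine (Finset.card_filter_le _ _).trans (le_of_eq ?_)
  rw [Finset.card_product, Finset.card_product, Finset.card_range, Int.card_Icc,
    Finset.card_univ, Fintype.card_fin]
  congr 2
  lia

theorem le_card_pshIndices (L : ℕ) : (L + 1) * (L + 1) ≤ (pshIndices L).card := by
  have h := Finset.card_le_card_of_injOn
    (s := Finset.range (L + 1) ×ˢ Finset.range (L + 1)) (t := pshIndices L)
    -- The square splits along the diagonal: one half gives the degrees `m ≥ 0`, the other those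
    -- with `m < 0`, where the shift by one avoids counting `m = 0` twice.
    (fun x => if x.2 ≤ x.1 then (x.1, (x.2 : ℤ), 0) else (x.2, -(x.1 : ℤ) - 1, 0))
    (fun x hx => by
      simp only [Finset.coe_product, Finset.coe_range, Set.mem_prod, Set.mem_Iio] at hx
      rw [Finset.mem_coe, mem_pshIndices]
      dsimp only
      split_ifs with hle
      · exact ⟨by lia, abs_le.2 ⟨by lia, by lia⟩, by simp⟩
      · exact ⟨by lia, abs_le.2 ⟨by lia, by lia⟩, by simp⟩)
    (fun x _ y _ hxy => by
      dsimp only at hxy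
      split_ifs at hxy <;> simp only [Prod.mk.injEq, and_true] at hxy <;>
        refine Prod.ext ?_ ?_ <;> lia)
  simpa using h

theorem card_storedEntries_le (L : ℕ) :
    (storedEntries L).card ≤ (pshIndices L).card * ((L + 1) * (2 * 4)) := by
  have h := Finset.card_le_card_of_injOn (s := storedEntries L)
    (t := pshIndices L ×ˢ (Finset.range (L + 1) ×ˢ
      ((Finset.univ : Finset Bool) ×ˢ (Finset.univ : Finset (Fin 4)))))
    -- The output index fixes `|mi|`, so one sign bit recovers the input degree.
    (fun e => (e.1, e.2.1, decide (0 ≤ e.2.2.1), e.2.2.2))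
    (fun e he => by
      simp only [storedEntries, allEntries, Finset.coe_filter, Finset.mem_product,
        Set.mem_ofPred_eq] at he
      have := (mem_pshIndices.1 he.1.2).1
      simp only [Finset.mem_coe, Finset.mem_product, Finset.mem_range, Finset.mem_univ, and_true]
      exact ⟨he.1.1, by lia⟩)
    (fun e he f hf hef => by
      simp only [storedEntries, Finset.coe_filter, Set.mem_ofPred_eq] at he hf
      simp only [Prod.mk.injEq, decide_eq_decide] at hef
      obtain ⟨h1, h2, h3, h4⟩ := hef
      have h5 : |e.2.2.1| = |f.2.2.1| := by rw [he.2, hf.2, h1]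
      have h6 : e.2.2.1 = f.2.2.1 := by
        rcases abs_eq_abs.1 h5 with h | h <;> lia
      exact Prod.ext h1 (Prod.ext h2 (Prod.ext h6 h4)))
  simpa [Finset.card_product] using h

theorem isTheta_card_allEntries :
    (fun L : ℕ => ((allEntries L).card : ℝ)) =Θ[atTop] (fun L : ℕ => 16 * (L : ℝ) ^ 4) := by
  constructor
  -- For `L ≥ 1` there are at most `4 · 2L · 3L = 24 L²` indices, and `24² = 36 · 16`.
  · refine IsBigO.of_bound 36 ?_
    filter_upwards [eventually_ge_atTop 1] with L hL
    have h1 : (pshIndices L).card ≤ 24 * L ^ 2 := by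
      refine (card_pshIndices_le L).trans ?_
      nlinarith
    have h2 : (allEntries L).card ≤ 36 * (16 * L ^ 4) := by
      rw [allEntries, Finset.card_product]
      refine (Nat.mul_le_mul h1 h1).trans (le_of_eq ?_)
      ring
    rw [Real.norm_of_nonneg (by positivity), Real.norm_of_nonneg (by positivity)]
    exact_mod_cast h2
  · refine IsBigO.of_bound 16 (Eventually.of_forall fun L => ?_)
    have h1 : L ^ 2 ≤ (pshIndices L).card := by
      refine le_trans ?_ (le_card_pshIndices L)
      nlinarith
    have h2 : 16 * L ^ 4 ≤ 16 * (allEntries L).card := by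
      rw [allEntries, Finset.card_product]
      refine Nat.mul_le_mul_left _ (le_trans (le_of_eq ?_) (Nat.mul_le_mul h1 h1))
      ring
    rw [Real.norm_of_nonneg (by positivity), Real.norm_of_nonneg (by positivity)]
    exact_mod_cast h2

theorem isBigO_card_storedEntries :
    (fun L : ℕ => ((storedEntries L).card : ℝ)) =O[atTop] (fun L : ℕ => 16 * (L : ℝ) ^ 3) := by
  refine IsBigO.of_bound 24 ?_
  filter_upwards [eventually_ge_atTop 1] with L hL
  have h1 : (pshIndices L).card ≤ 24 * L ^ 2 := by
    refine (card_pshIndices_le L).trans ?_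
    nlinarith
  have h2 : (storedEntries L).card ≤ 24 * (16 * L ^ 3) := by
    refine (card_storedEntries_le L).trans
      ((Nat.mul_le_mul h1 (show (L + 1) * (2 * 4) ≤ 16 * L by lia)).trans (le_of_eq ?_))
    ring
  rw [Real.norm_of_nonneg (by positivity), Real.norm_of_nonneg (by positivity)]
  exact_mod_cast h2

end PSH

theorem mainTheorem6 :
    (∀ P : MuellerField, P.IsIntegrable → P.IsIsotropic →
      (∀ (lo : ℕ) (mo : ℤ) (po : Fin 4) (li : ℕ) (mi : ℤ) (pi : Fin 4),
        IsPSHIndex lo mo po → IsPSHIndex li mi pi →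
        |mi| ≠ |mo| → pshCoeff P lo mo po li mi pi = 0) ∧
      (∀ (lo : ℕ) (mo : ℤ) (li : ℕ) (mi : ℤ),
        2 ≤ lo → |mo| ≤ lo → 2 ≤ li → |mi| ≤ li →
        (mi ≠ mo →
          isoCoeff P lo mo li mi = 0 ∧ isoPart (coeffBlock P lo mo li mi) = 0) ∧
        (mi ≠ -mo →
          conjCoeff P lo mo li mi = 0 ∧ conjPart (coeffBlock P lo mo li mi) = 0)) ∧
      (∀ L : ℕ, ∀ e ∈ allEntries L,
        pshCoeff P e.1.1 e.1.2.1 e.1.2.2 e.2.1 e.2.2.1 e.2.2.2 ≠ 0 → e ∈ storedEntries L)) ∧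
    (fun L : ℕ => ((allEntries L).card : ℝ)) =Θ[atTop] (fun L : ℕ => 16 * (L : ℝ) ^ 4) ∧
    (fun L : ℕ => ((storedEntries L).card : ℝ)) =O[atTop] (fun L : ℕ => 16 * (L : ℝ) ^ 3) := by
  refine ⟨fun P hI hP => ⟨fun lo mo po li mi pi ho hi hm => pshCoeff_eq_zero hI hP ho hi hm,
    fun lo mo li mi ho _ hi _ => ⟨fun hm => ?_, fun hm => ?_⟩, fun L e he hne => ?_⟩,
    isTheta_card_allEntries, isBigO_card_storedEntries⟩
  · rw [isoPart_coeffBlock hI ho hi, and_self]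
    exact isoCoeff_eq_zero hP lo li hm
  · rw [conjPart_coeffBlock hI ho hi, and_self]
    exact conjCoeff_eq_zero hP lo li hm
  · refine Finset.mem_filter.2 ⟨he, not_not.1 fun hm => hne ?_⟩
    obtain ⟨h1, h2⟩ := Finset.mem_product.1 he
    exact pshCoeff_eq_zero hI hP (mem_pshIndices.1 h1).2 (mem_pshIndices.1 h2).2 hm
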